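/- Let $q:(0,\infty)\to\mathbb{R}$ be a piecewise continuous potential (on every compact subinterval of $(0,\infty)$ it has only finitely many discontinuities, and it has finite one-sided limits at every $r>0$) such that $$(H_1)\quad \int_0^1 r^{1-2\epsilon}\,|q(r)|\,dr<\infty \ \text{ for some } \epsilon>0, \qquad (H_2)\quad \int_1^{\infty}|q(r)|\,dr<\infty .$$ For $\nu\in\mathbb{C}$ with $\operatorname{Re}\nu\ge 0$ consider the radial Schrödinger equation at energy $1$, $$-u''+\Big(\frac{\nu^2-\frac14}{r^2}+q(r)\Big)u=u,\qquad r>0,$$ where solutions are $C^1$ on $(0,\infty)$ and satisfy the equation at every point of continuity of $q$. Let $\varphi(r,\nu)$ be the regular solution, i.e. the solution with $\varphi(r,\nu)\sim r^{\nu+\frac12}$ as $r\to0^+$, let $f^{\pm}(r,\nu)$ be the Jost solutions, i.e. the solutions with $f^{\pm}(r,\nu)\sim e^{\pm ir}$ as $r\to+\infty$, and let the Jost functions $\alpha(\nu),\beta(\nu)\in\mathbb{C}$ be defined by $$\varphi(r,\nu)=\alpha(\nu)f^+(r,\nu)+\beta(\nu)f^-(r,\nu),\qquad r>0.$$ Then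 $\alpha(\nu)\neq0$ for all $\nu$ in the closed first quadrant $\{\operatorname{Re}\nu\ge0,\ \operatorname{Im}\nu\ge0\}$, and $\beta(\nu)\ne0$ for all $\nu$ in the closed fourth quadrant $\{\operatorname{Re}\nu\ge0,\ \operatorname{Im}\nu\le0\}$. In other words, the Regge poles, that is, the zeros of $\beta$ in the half-plane $\operatorname{Re}\nu\ge0$, all belong to the closed first quadrant. -/

import Mathlib

open Set Filter Topology MeasureTheory

noncomputable section

namespace ReggePoles

/-- `q` is piecewise continuous on `(0,∞)`: every compact subinterval of `(0,∞)` contains only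
finitely many discontinuities of `q`, and `q` has finite one-sided limits at every `r > 0`.
The values of `q` on `(-∞,0]` are never used. -/
def PiecewiseContinuous (q : ℝ → ℝ) : Prop :=
  (∀ a b : ℝ, 0 < a → {r ∈ Icc a b | ¬ ContinuousAt q r}.Finite) ∧
  ∀ r : ℝ, 0 < r →
    (∃ l : ℝ, Tendsto q (𝓝[<] r) (𝓝 l)) ∧ (∃ l : ℝ, Tendsto q (𝓝[>] r) (𝓝 l))

/-- Hypothesis `(H₁)`: `∫₀¹ r ^ (1 - 2ε) |q(r)| dr < ∞` for some `ε > 0`. -/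
def HypH1 (q : ℝ → ℝ) : Prop :=
  ∃ ε : ℝ, 0 < ε ∧ IntegrableOn (fun r : ℝ => r ^ (1 - 2 * ε) * |q r|) (Ioo 0 1)

/-- Hypothesis `(H₂)`: `∫₁^∞ |q(r)| dr < ∞`. -/
def HypH2 (q : ℝ → ℝ) : Prop :=
  IntegrableOn (fun r : ℝ => |q r|) (Ioi 1)

/-- `u` is a solution on `(0,∞)` of the radial Schrödinger equation at energy `1`,
`-u'' + ((ν² - 1/4) / r² + q(r)) u = u`: it is `C¹` on `(0,∞)`, and it is twice differentiable
and satisfies the equation at each `r > 0` where the piecewise continuous `q` is continuous. -/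
structure IsRadialSolution (q : ℝ → ℝ) (ν : ℂ) (u : ℝ → ℂ) : Prop where
  contDiffOn : ContDiffOn ℝ 1 u (Ioi 0)
  differentiableAt : ∀ r : ℝ, 0 < r → ContinuousAt q r → DifferentiableAt ℝ (deriv u) r
  equation : ∀ r : ℝ, 0 < r → ContinuousAt q r →
    -(deriv (deriv u) r) + ((ν ^ 2 - 1 / 4) / (r : ℂ) ^ 2 + (q r : ℂ)) * u r = u r

/-- The regular solution: `φ(r) ∼ r ^ (ν + 1/2)` as `r → 0⁺`. -/
structure IsRegularSolution (q : ℝ → ℝ) (ν : ℂ) (φ : ℝ → ℂ) : Prop where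
  solution : IsRadialSolution q ν φ
  asymptotic : Asymptotics.IsEquivalent (𝓝[>] (0 : ℝ)) φ
    (fun r : ℝ => (r : ℂ) ^ (ν + 1 / 2))

/-- The Jost solution with sign `s = 1` or `s = -1`: `f(r) ∼ e ^ (s i r)` as `r → ∞`. -/
structure IsJostSolution (q : ℝ → ℝ) (ν : ℂ) (s : ℂ) (f : ℝ → ℂ) : Prop where
  solution : IsRadialSolution q ν f
  asymptotic : Asymptotics.IsEquivalent atTop f
    (fun r : ℝ => Complex.exp (s * Complex.I * (r : ℂ)))

/-- The regular solution `φ(·, ν)`. Under `(H₁)` and for `Re ν ≥ 0` it exists and is unique on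
`(0,∞)`. The default value `0` is used only if there is no such solution. -/
def regularSolution (q : ℝ → ℝ) (ν : ℂ) : ℝ → ℂ :=
  open Classical in
  if h : ∃ φ : ℝ → ℂ, IsRegularSolution q ν φ then h.choose else 0

/-- The Jost solution `f⁺(·, ν)` (for `s = 1`) or `f⁻(·, ν)` (for `s = -1`). Under `(H₂)` it exists
and is unique on `(0,∞)`. The default value `0` is used only if there is no such solution. -/
def jostSolution (q : ℝ → ℝ) (s : ℂ) (ν : ℂ) : ℝ → ℂ :=
  open Classical in
  if h : ∃ f : ℝ → ℂ, IsJostSolution q ν s f then h.choose else 0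

/-- `φ(r, ν) = c.1 f⁺(r, ν) + c.2 f⁻(r, ν)` for all `r > 0`. -/
def IsJostPair (q : ℝ → ℝ) (ν : ℂ) (c : ℂ × ℂ) : Prop :=
  ∀ r : ℝ, 0 < r →
    regularSolution q ν r = c.1 * jostSolution q 1 ν r + c.2 * jostSolution q (-1) ν r

/-- The pair `(α(ν), β(ν))` of coefficients of the regular solution in the fundamental system
`f⁺, f⁻`. The default value `(0, 0)` is used only if there is no such pair. -/
def jostPair (q : ℝ → ℝ) (ν : ℂ) : ℂ × ℂ :=
  open Classical in
  if h : ∃ c : ℂ × ℂ, IsJostPair q ν c then h.choose else 0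

/-- The Jost function `α`. -/
def jostAlpha (q : ℝ → ℝ) (ν : ℂ) : ℂ := (jostPair q ν).1

/-- The Jost function `β`. -/
def jostBeta (q : ℝ → ℝ) (ν : ℂ) : ℂ := (jostPair q ν).2

/-- The closed first quadrant. -/
def firstQuadrant : Set ℂ := {ν | 0 ≤ ν.re ∧ 0 ≤ ν.im}

/-- The closed fourth quadrant. -/
def fourthQuadrant : Set ℂ := {ν | 0 ≤ ν.re ∧ ν.im ≤ 0}

/-- The Regge poles: the zeros of the Jost function `β`, the complex angular momentum `ν` ranging
over the half-plane `Re ν ≥ 0`. -/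
def reggePoles (q : ℝ → ℝ) : Set ℂ := {ν | 0 ≤ ν.re ∧ jostBeta q ν = 0}

end ReggePoles

end

/-! The proof follows the current `Im (u' ū)` of a solution. Since `q`, the energy and `1/4` are
real, its derivative is `Im (ν²) |u|² / r²` (`Admissible.hasDerivAt_current`), which for `Re ν ≥ 0`
has the sign of `Im ν`. For the regular solution `φ` the current near the origin is `Im ν |φ|² / r`
plus a term tending to `0` (`current_eq_amplitude`), so by monotonicity the current has the sign of
`Im ν` on the whole half-line (`Admissible.current_nonneg`).

If `α(ν) = 0` with `Im ν ≥ 0`, then `φ = β f⁻` and its current tends to `-|β|²` at infinity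
(`Admissible.tendsto_current_jost`). Hence `β = 0`, so `φ` vanishes, against its normalisation at
the origin. The case `β(ν) = 0` with `Im ν ≤ 0` is the mirror image, and
`Admissible.regular_ne_mul_jost` treats both through a sign `σ`.

The remaining work is analytic. The solutions are chosen from existence statements, so existence has
to be proved; this is done by Volterra equations in weighted supremum norms
(`exists_weighted_fixedPoint`). The chosen solutions are known only through their own asymptotics,
whereas the current involves derivatives. Comparing an arbitrary solution with a constructed one by
Wronskians yields the behaviour of the derivative at the origin (`Admissible.tendsto_quasiDeriv`)
and at infinity (`Admissible.tendsto_deriv_jost`). -/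

noncomputable section

namespace ReggePoles

/-! ### Primitives on the half-line of functions with countably many discontinuities. -/

section Calculus

variable {E : Type*} [NormedAddCommGroup E]

theorem intervalIntegrable_of_continuousOn_Ioi {g : ℝ → E} (hg : ContinuousOn g (Ioi 0))
    {a b : ℝ} (ha : 0 < a) (hb : 0 < b) : IntervalIntegrable g volume a b := by
  refine (hg.mono fun x hx => ?_).intervalIntegrable
  exact lt_of_lt_of_le (lt_min ha hb) hx.1

theorem intervalIntegrable_of_integrableOn_Ioi {F : ℝ → E}
    (hF : ∀ r, 0 < r → IntegrableOn F (Ioi r)) {a b : ℝ} (ha : 0 < a) (hb : 0 < b) :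
    IntervalIntegrable F volume a b :=
  ⟨(hF a ha).mono_set Ioc_subset_Ioi_self, (hF b hb).mono_set Ioc_subset_Ioi_self⟩

variable [NormedSpace ℝ E]

/-- A continuous function on the half-line whose derivative agrees with a continuous function off
a countable set is continuously differentiable. -/
theorem hasDerivAt_of_off_countable [CompleteSpace E] {f g : ℝ → E} {C : Set ℝ} (hC : C.Countable)
    (hf : ContinuousOn f (Ioi 0)) (hg : ContinuousOn g (Ioi 0))
    (hd : ∀ r, 0 < r → r ∉ C → HasDerivAt f (g r) r) {r : ℝ} (hr : 0 < r) :
    HasDerivAt f (g r) r := by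
  have key : ∀ x, 0 < x → f x = f r + ∫ t in r..x, g t := by
    intro x hx
    have hsub : uIcc r x ⊆ Ioi 0 := fun y hy => lt_of_lt_of_le (lt_min hr hx) hy.1
    rw [integral_eq_of_hasDerivAt_off_countable f g hC (hf.mono hsub)
      (fun y hy => hd y (lt_trans (lt_min hr hx) hy.1.1) hy.2)
      (intervalIntegrable_of_continuousOn_Ioi hg hr hx)]
    abel
  have h1 : HasDerivAt (fun x => f r + ∫ t in r..x, g t) (g r) r := by
    refine HasDerivAt.const_add _ ?_
    refine intervalIntegral.integral_hasDerivAt_right (by simp) ?_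
      (hg.continuousAt (Ioi_mem_nhds hr))
    exact AEStronglyMeasurable.stronglyMeasurableAtFilter_of_mem
      (hg.aestronglyMeasurable measurableSet_Ioi) (Ioi_mem_nhds hr)
  refine h1.congr_of_eventuallyEq ?_
  filter_upwards [Ioi_mem_nhds hr] with x hx using key x hx

theorem continuousOn_primitive_zero {F : ℝ → E}
    (hF : ∀ r, 0 < r → IntervalIntegrable F volume 0 r) :
    ContinuousOn (fun r => ∫ t in (0 : ℝ)..r, F t) (Ici 0) := by
  intro r hr
  have hr1 : (0 : ℝ) < r + 1 := by have : (0 : ℝ) ≤ r := hr; linarith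
  have h := intervalIntegral.continuousOn_primitive_interval' (hF (r + 1) hr1) left_mem_uIcc
  rw [uIcc_of_le hr1.le] at h
  refine (h r ⟨hr, by linarith⟩).mono_of_mem_nhdsWithin ?_
  rw [← Ici_inter_Iic]
  exact inter_mem self_mem_nhdsWithin (mem_nhdsWithin_of_mem_nhds (Iic_mem_nhds (by linarith)))

theorem tendsto_primitive_zero {F : ℝ → E}
    (hF : ∀ r, 0 < r → IntervalIntegrable F volume 0 r) :
    Tendsto (fun r => ∫ t in (0 : ℝ)..r, F t) (𝓝[>] 0) (𝓝 0) := by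
  have h := (continuousOn_primitive_zero hF 0 self_mem_Ici).tendsto
  simp only [intervalIntegral.integral_same] at h
  exact h.mono_left (nhdsWithin_mono _ Ioi_subset_Ici_self)

theorem hasDerivAt_primitive_zero [CompleteSpace E] {F : ℝ → E}
    (hF : ∀ r, 0 < r → IntervalIntegrable F volume 0 r) {r : ℝ} (hr : 0 < r)
    (hc : ContinuousAt F r) : HasDerivAt (fun r => ∫ t in (0 : ℝ)..r, F t) (F r) r := by
  refine intervalIntegral.integral_hasDerivAt_right (hF r hr) ?_ hc
  have := (hF (r + 1) (by linarith)).1.aestronglyMeasurable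
  exact AEStronglyMeasurable.stronglyMeasurableAtFilter_of_mem this (Ioc_mem_nhds hr (by linarith))

theorem integral_Ioi_eq_sub {F : ℝ → E} (hF : ∀ r, 0 < r → IntegrableOn F (Ioi r))
    {r x : ℝ} (hr : 0 < r) (hx : 0 < x) :
    ∫ t in Ioi x, F t = (∫ t in Ioi r, F t) - ∫ t in r..x, F t := by
  rw [← intervalIntegral.integral_interval_add_Ioi (hF r hr) (hF x hx)]
  abel

theorem continuousOn_integral_Ioi {F : ℝ → E} (hF : ∀ r, 0 < r → IntegrableOn F (Ioi r)) :
    ContinuousOn (fun r => ∫ t in Ioi r, F t) (Ioi 0) := by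
  intro r hr
  have hr : 0 < r := hr
  have h := intervalIntegral.continuousOn_primitive_interval'
    (intervalIntegrable_of_integrableOn_Ioi hF (half_pos hr) (by linarith : 0 < r + 1))
    (a := r) (by rw [uIcc_of_le (by linarith)]; constructor <;> linarith)
  rw [uIcc_of_le (by linarith)] at h
  have h2 : ContinuousAt (fun x => ∫ t in r..x, F t) r :=
    h.continuousAt (Icc_mem_nhds (by linarith) (by linarith))
  have h3 : ContinuousAt (fun x => (∫ t in Ioi r, F t) - ∫ t in r..x, F t) r :=
    continuousAt_const.sub h2
  refine (h3.congr ?_).continuousWithinAt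
  filter_upwards [Ioi_mem_nhds hr] with x hx using (integral_Ioi_eq_sub hF hr hx).symm

theorem hasDerivAt_integral_Ioi [CompleteSpace E] {F : ℝ → E}
    (hF : ∀ r, 0 < r → IntegrableOn F (Ioi r)) {r : ℝ} (hr : 0 < r)
    (hc : ContinuousAt F r) : HasDerivAt (fun r => ∫ t in Ioi r, F t) (-F r) r := by
  have h1 : HasDerivAt (fun x => ∫ t in r..x, F t) (F r) r := by
    refine intervalIntegral.integral_hasDerivAt_right (by simp) ?_ hc
    exact AEStronglyMeasurable.stronglyMeasurableAtFilter_of_mem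
      (hF (r / 2) (half_pos hr)).aestronglyMeasurable (Ioi_mem_nhds (by linarith))
  refine (h1.const_sub (∫ t in Ioi r, F t)).congr_of_eventuallyEq ?_
  filter_upwards [Ioi_mem_nhds hr] with x hx using integral_Ioi_eq_sub hF hr hx

theorem tendsto_integral_Ioi {F : ℝ → E} (hF : ∀ r, 0 < r → IntegrableOn F (Ioi r)) :
    Tendsto (fun r => ∫ t in Ioi r, F t) atTop (𝓝 0) := by
  have h1 := intervalIntegral_tendsto_integral_Ioi 1 (hF 1 one_pos) tendsto_id
  have h2 := (tendsto_const_nhds (x := ∫ t in Ioi (1 : ℝ), F t)).sub h1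
  rw [sub_self] at h2
  refine h2.congr' ?_
  filter_upwards [eventually_gt_atTop 0] with x hx
    using (integral_Ioi_eq_sub hF one_pos hx).symm

end Calculus

/-! ### Exponential weights for Volterra equations. -/

section Weights

variable {h : ℝ → ℝ} {C : Set ℝ}

/-- The weight `exp (2 ∫₀^r h)`. -/
def weightZero (h : ℝ → ℝ) (r : ℝ) : ℝ := Real.exp (2 * ∫ t in (0 : ℝ)..r, h t)

/-- The weight `exp (2 ∫_r^∞ h)`. -/
def weightInfty (h : ℝ → ℝ) (r : ℝ) : ℝ := Real.exp (2 * ∫ t in Ioi r, h t)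

theorem continuousOn_weightZero (hF : ∀ r, 0 < r → IntervalIntegrable h volume 0 r) :
    ContinuousOn (weightZero h) (Ici 0) :=
  Real.continuous_exp.comp_continuousOn (continuousOn_const.mul (continuousOn_primitive_zero hF))

theorem intervalIntegrable_mul_weightZero (hF : ∀ r, 0 < r → IntervalIntegrable h volume 0 r)
    {r : ℝ} (hr : 0 < r) : IntervalIntegrable (fun t => h t * weightZero h t) volume 0 r := by
  refine (hF r hr).mul_continuousOn ((continuousOn_weightZero hF).mono ?_)
  rw [uIcc_of_le hr.le]
  exact Icc_subset_Ici_self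

/-- Off `C` the integrand is the derivative of `weightZero h / 2`. The factor `2` in the exponent of
the weight thus becomes the factor `1/2` that makes the Volterra operators contractions. -/
theorem integral_mul_weightZero_le (hC : C.Countable)
    (hF : ∀ r, 0 < r → IntervalIntegrable h volume 0 r)
    (hc : ∀ r, 0 < r → r ∉ C → ContinuousAt h r) {r : ℝ} (hr : 0 < r) :
    ∫ t in (0 : ℝ)..r, h t * weightZero h t ≤ weightZero h r / 2 := by
  have := integral_eq_of_hasDerivAt_off_countable (fun r => weightZero h r / 2)
    (fun t => h t * weightZero h t) hC (a := 0) (b := r)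
    (((continuousOn_weightZero hF).mono
      (by rw [uIcc_of_le hr.le]; exact Icc_subset_Ici_self)).div_const _)
    (by
      intro x hx
      rw [min_eq_left hr.le] at hx
      have h1 := ((hasDerivAt_primitive_zero hF hx.1.1 (hc x hx.1.1 hx.2)).const_mul
        2).exp.div_const 2
      exact h1.congr_deriv (by change _ = h x * Real.exp _; ring))
    (intervalIntegrable_mul_weightZero hF hr)
  rw [this]
  have : 0 < weightZero h 0 := Real.exp_pos _
  linarith

theorem one_le_weightZero (hh : ∀ r, 0 < r → 0 ≤ h r) {r : ℝ} (hr : 0 < r) :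
    1 ≤ weightZero h r := by
  refine Real.one_le_exp (mul_nonneg zero_le_two ?_)
  rw [intervalIntegral.integral_of_le hr.le]
  exact setIntegral_nonneg measurableSet_Ioc fun t ht => hh t ht.1

theorem continuousOn_weightInfty (hF : ∀ r, 0 < r → IntegrableOn h (Ioi r)) :
    ContinuousOn (weightInfty h) (Ioi 0) :=
  Real.continuous_exp.comp_continuousOn (continuousOn_const.mul (continuousOn_integral_Ioi hF))

theorem one_le_weightInfty (hh : ∀ r, 0 < r → 0 ≤ h r) {r : ℝ} (hr : 0 < r) :
    1 ≤ weightInfty h r :=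
  Real.one_le_exp (mul_nonneg zero_le_two
    (setIntegral_nonneg measurableSet_Ioi fun t ht => hh t (hr.trans ht)))

theorem weightInfty_anti (hF : ∀ r, 0 < r → IntegrableOn h (Ioi r))
    (hh : ∀ r, 0 < r → 0 ≤ h r) {s r : ℝ} (hs : 0 < s) (hsr : s ≤ r) :
    weightInfty h r ≤ weightInfty h s := by
  refine Real.exp_le_exp.2 (mul_le_mul_of_nonneg_left ?_ zero_le_two)
  refine setIntegral_mono_set (hF s hs) ?_ (Ioi_subset_Ioi hsr).eventuallyLE
  filter_upwards [ae_restrict_mem measurableSet_Ioi] with t ht using hh t (hs.trans ht)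

theorem integrableOn_mul_weightInfty (hF : ∀ r, 0 < r → IntegrableOn h (Ioi r))
    (hh : ∀ r, 0 < r → 0 ≤ h r) {r : ℝ} (hr : 0 < r) :
    IntegrableOn (fun t => h t * weightInfty h t) (Ioi r) := by
  refine Integrable.mul_bdd (c := weightInfty h r) (hF r hr) ?_ ?_
  · exact ((continuousOn_weightInfty hF).mono (Ioi_subset_Ioi hr.le)).aestronglyMeasurable
      measurableSet_Ioi
  · filter_upwards [ae_restrict_mem measurableSet_Ioi] with t ht
    -- The weight decreases in its argument, so on the ray it is bounded by its value at the
    -- endpoint.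
    refine (Real.norm_of_nonneg (Real.exp_pos (2 * ∫ s in Ioi t, h s)).le).trans_le ?_
    exact weightInfty_anti hF hh hr (le_of_lt ht)

theorem integral_mul_weightInfty_le (hC : C.Countable)
    (hF : ∀ r, 0 < r → IntegrableOn h (Ioi r)) (hh : ∀ r, 0 < r → 0 ≤ h r)
    (hc : ∀ r, 0 < r → r ∉ C → ContinuousAt h r) {r : ℝ} (hr : 0 < r) :
    ∫ t in Ioi r, h t * weightInfty h t ≤ weightInfty h r / 2 := by
  refine le_of_tendsto (intervalIntegral_tendsto_integral_Ioi r
    (integrableOn_mul_weightInfty hF hh hr) tendsto_id) ?_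
  filter_upwards [eventually_ge_atTop r] with R hR
  have hR0 : 0 < R := hr.trans_le hR
  have hsub : uIcc r R ⊆ Ioi 0 := by
    rw [uIcc_of_le hR]; exact fun y hy => hr.trans_le hy.1
  have := integral_eq_of_hasDerivAt_off_countable (fun r => - weightInfty h r / 2)
    (fun t => h t * weightInfty h t) hC (a := r) (b := R)
    (((continuousOn_weightInfty hF).mono hsub).neg.div_const _)
    (by
      intro x hx
      rw [min_eq_left hR] at hx
      have hx0 : 0 < x := hr.trans hx.1.1
      have h1 := ((hasDerivAt_integral_Ioi hF hx0 (hc x hx0 hx.2)).const_mul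
        2).exp.neg.div_const 2
      exact h1.congr_deriv (by change _ = h x * Real.exp _; ring))
    (intervalIntegrable_of_integrableOn_Ioi
      (fun s hs => integrableOn_mul_weightInfty hF hh hs) hr hR0)
  simp only [id]
  rw [this]
  have : 0 < weightInfty h R := Real.exp_pos _
  linarith

end Weights

/-! ### A contraction principle in a weighted supremum norm. -/

section FixedPoint

/-- The functions that are continuous on `(0,∞)` and bounded there by a multiple of `ω`. -/
def WeightedBounded (ω : ℝ → ℝ) (y : ℝ → ℂ) : Prop :=
  ContinuousOn y (Ioi 0) ∧ ∃ M : ℝ, ∀ r, 0 < r → ‖y r‖ ≤ M * ω r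

/-- An affine equation `y = y₀ + T y` whose linear part halves the weighted supremum norm has a
solution. -/
theorem exists_weighted_fixedPoint {ω : ℝ → ℝ} (hω : ContinuousOn ω (Ioi 0))
    (hpos : ∀ r, 0 < r → 0 < ω r) (T : (ℝ → ℂ) → ℝ → ℂ)
    (hcont : ∀ y, WeightedBounded ω y → ContinuousOn (T y) (Ioi 0))
    (hsub : ∀ y z, WeightedBounded ω y → WeightedBounded ω z →
      ∀ r, 0 < r → T y r - T z r = T (y - z) r)
    (hbound : ∀ y M, WeightedBounded ω y → (∀ r, 0 < r → ‖y r‖ ≤ M * ω r) →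
      ∀ r, 0 < r → ‖T y r‖ ≤ M / 2 * ω r)
    {y₀ : ℝ → ℂ} (hy₀ : WeightedBounded ω y₀) :
    ∃ y, WeightedBounded ω y ∧ ∀ r, 0 < r → y r = y₀ r + T y r := by
  classical
  -- Division by `ω` identifies the weighted space with the bounded continuous functions on `(0,∞)`,
  -- a complete space; `ext` is the inverse map. The affine map becomes a contraction of ratio `1/2`
  -- there.
  let X := BoundedContinuousFunction (Ioi (0 : ℝ)) ℂ
  let ext : X → ℝ → ℂ := fun g r => if hr : 0 < r then (ω r : ℂ) * g ⟨r, hr⟩ else 0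
  have ext_eq : ∀ (g : X) (r : ℝ) (hr : 0 < r), ext g r = (ω r : ℂ) * g ⟨r, hr⟩ :=
    fun g r hr => dif_pos hr
  have ext_bd : ∀ (g : X) (r : ℝ), 0 < r → ‖ext g r‖ ≤ ‖g‖ * ω r := by
    intro g r hr
    rw [ext_eq g r hr, norm_mul, Complex.norm_real, Real.norm_of_nonneg (hpos r hr).le, mul_comm]
    exact mul_le_mul_of_nonneg_right (g.norm_coe_le_norm _) (hpos r hr).le
  have ext_wb : ∀ g : X, WeightedBounded ω (ext g) := by
    refine fun g => ⟨?_, ‖g‖, ext_bd g⟩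
    rw [continuousOn_iff_continuous_domRestrict]
    have : (Ioi (0 : ℝ)).domRestrict (ext g) = fun x : Ioi (0 : ℝ) => ((ω x : ℝ) : ℂ) * g x := by
      funext x; exact ext_eq g x x.2
    rw [this]
    exact (Complex.continuous_ofReal.comp
      (continuousOn_iff_continuous_domRestrict.1 hω)).mul g.continuous
  obtain ⟨hy₀c, M₀, hM₀⟩ := hy₀
  have val_cont : ∀ g : X, Continuous fun x : Ioi (0 : ℝ) => (y₀ x + T (ext g) x) / (ω x : ℂ) := by
    intro g
    refine Continuous.div ((continuousOn_iff_continuous_domRestrict.1 hy₀c).add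
      (continuousOn_iff_continuous_domRestrict.1 (hcont _ (ext_wb g))))
      (Complex.continuous_ofReal.comp (continuousOn_iff_continuous_domRestrict.1 hω)) ?_
    intro x
    exact Complex.ofReal_ne_zero.2 (hpos x x.2).ne'
  have val_bd : ∀ (g : X) (x : Ioi (0 : ℝ)),
      ‖(y₀ x + T (ext g) x) / (ω x : ℂ)‖ ≤ M₀ + ‖g‖ / 2 := by
    intro g x
    rw [norm_div, Complex.norm_real, Real.norm_of_nonneg (hpos x x.2).le,
      div_le_iff₀ (hpos x x.2), add_mul]
    exact (norm_add_le _ _).trans (add_le_add (hM₀ x x.2)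
      (hbound _ _ (ext_wb g) (ext_bd g) x x.2))
  let Φ : X → X := fun g => BoundedContinuousFunction.ofNormedAddCommGroup
    (fun x : Ioi (0 : ℝ) => (y₀ x + T (ext g) x) / (ω x : ℂ)) (val_cont g) (M₀ + ‖g‖ / 2)
    (val_bd g)
  have hΦ : ContractingWith (1 / 2) Φ := by
    refine ⟨by norm_num, LipschitzWith.of_dist_le_mul fun g k => ?_⟩
    rw [BoundedContinuousFunction.dist_le (by positivity)]
    intro x
    have hx : 0 < ω x := hpos x x.2
    change dist ((y₀ x + T (ext g) x) / (ω x : ℂ)) ((y₀ x + T (ext k) x) / (ω x : ℂ)) ≤ _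
    rw [dist_eq_norm, ← sub_div, add_sub_add_left_eq_sub, hsub _ _ (ext_wb g) (ext_wb k) x x.2,
      norm_div, Complex.norm_real, Real.norm_of_nonneg hx.le, div_le_iff₀ hx]
    have hext : ext g - ext k = ext (g - k) := by
      funext r
      by_cases hr : 0 < r
      · rw [Pi.sub_apply, ext_eq _ _ hr, ext_eq _ _ hr, ext_eq _ _ hr,
          BoundedContinuousFunction.sub_apply, mul_sub]
      · simp [ext, hr]
    rw [hext]
    refine (hbound _ _ (ext_wb _) (ext_bd _) x x.2).trans (le_of_eq ?_)
    rw [dist_eq_norm]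
    push_cast
    ring
  obtain ⟨g, hg⟩ : ∃ g, Φ g = g := ⟨_, hΦ.fixedPoint_isFixedPt⟩
  refine ⟨ext g, ext_wb g, fun r hr => ?_⟩
  have h1 : (y₀ r + T (ext g) r) / (ω r : ℂ) = g ⟨r, hr⟩ :=
    congrArg (fun k : X => k ⟨r, hr⟩) hg
  rw [ext_eq g r hr, ← h1, mul_div_cancel₀]
  exact Complex.ofReal_ne_zero.2 (hpos r hr).ne'

end FixedPoint

/-! ### Integrability and regularity of the potential. -/

section Potential

theorem PiecewiseContinuous.countable_discontinuities {q : ℝ → ℝ} (hq : PiecewiseContinuous q) :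
    {r : ℝ | 0 < r ∧ ¬ ContinuousAt q r}.Countable := by
  have h : {r : ℝ | 0 < r ∧ ¬ ContinuousAt q r} ⊆
      ⋃ n : ℕ, {r ∈ Icc (1 / ((n : ℝ) + 1)) n | ¬ ContinuousAt q r} := by
    rintro r ⟨hr, hc⟩
    obtain ⟨n, hn⟩ := exists_nat_ge (max r (1 / r))
    refine mem_iUnion.2 ⟨n, ⟨?_, (le_max_left _ _).trans hn⟩, hc⟩
    rw [div_le_iff₀ (by positivity)]
    have := (div_le_iff₀ hr).1 ((le_max_right _ _).trans hn)
    nlinarith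
  exact (countable_iUnion fun n => (hq.1 _ _ (by positivity)).countable).mono h

theorem aestronglyMeasurable_of_continuousAt_off_countable {q : ℝ → ℝ} {C : Set ℝ}
    (hC : C.Countable) (hc : ∀ r, 0 < r → r ∉ C → ContinuousAt q r) :
    AEStronglyMeasurable q (volume.restrict (Ioi 0)) := by
  have h1 : AEStronglyMeasurable q (volume.restrict (Ioi 0 \ C)) :=
    ContinuousOn.aestronglyMeasurable (fun r hr => (hc r hr.1 hr.2).continuousWithinAt)
      (measurableSet_Ioi.diff hC.measurableSet)
  rwa [Measure.restrict_congr_set (sdiff_null_ae_eq_self (hC.measure_zero volume))] at h1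

/-- The consequences of piecewise continuity, `(H₁)` and `(H₂)` on which the analysis of the radial
equation rests. -/
structure Admissible (q : ℝ → ℝ) (δ : ℝ) (C : Set ℝ) : Prop where
  countable : C.Countable
  continuousAt : ∀ r, 0 < r → r ∉ C → ContinuousAt q r
  pos : 0 < δ
  le_one : δ ≤ 1
  aestronglyMeasurable : AEStronglyMeasurable q (volume.restrict (Ioi 0))
  intervalIntegrable_zero : ∀ r, 0 < r →
    IntervalIntegrable (fun t => t ^ (1 - δ) * |q t - 1|) volume 0 r
  integrableOn_Ioi : ∀ r, 0 < r → IntegrableOn q (Ioi r)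

theorem continuousOn_rpow_const_Ioi (p : ℝ) : ContinuousOn (fun t : ℝ => t ^ p) (Ioi 0) :=
  fun t ht => (Real.continuousAt_rpow_const t p (Or.inl (ne_of_gt ht))).continuousWithinAt

theorem exists_admissible {q : ℝ → ℝ} (hq : PiecewiseContinuous q) (h1 : HypH1 q)
    (h2 : HypH2 q) : ∃ δ C, Admissible q δ C := by
  obtain ⟨ε, hε, hint⟩ := h1
  set C := {r : ℝ | 0 < r ∧ ¬ ContinuousAt q r} with hCdef
  have hC : C.Countable := hq.countable_discontinuities
  have hc : ∀ r, 0 < r → r ∉ C → ContinuousAt q r := by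
    intro r hr hrC
    by_contra h
    exact hrC ⟨hr, h⟩
  have hm := aestronglyMeasurable_of_continuousAt_off_countable hC hc
  have hm' : ∀ s : Set ℝ, s ⊆ Ioi 0 → AEStronglyMeasurable q (volume.restrict s) :=
    fun s hs => hm.mono_measure (Measure.restrict_mono hs le_rfl)
  -- On `(0,1]` lowering `2ε` to `δ` only decreases `r ^ (1 - 2ε)`; the cap at `1` keeps the
  -- exponent `1 - δ` nonnegative, so that this power is monotone.
  set δ := min (2 * ε) 1 with hδ
  have hδ0 : 0 < δ := lt_min (by linarith) one_pos
  have hδ1 : δ ≤ 1 := min_le_right _ _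
  have hint' : IntegrableOn (fun t : ℝ => t ^ (1 - δ) * |q t|) (Ioc 0 1) := by
    rw [← integrableOn_Ioc_iff_integrableOn_Ioo] at hint
    refine Integrable.mono' hint ?_ ?_
    · exact (((continuousOn_rpow_const_Ioi _).mono Ioc_subset_Ioi_self).aestronglyMeasurable
        measurableSet_Ioc).mul (hm' _ Ioc_subset_Ioi_self).norm
    · filter_upwards [ae_restrict_mem measurableSet_Ioc] with t ht
      rw [Real.norm_of_nonneg (mul_nonneg (Real.rpow_nonneg ht.1.le _) (abs_nonneg _))]
      refine mul_le_mul_of_nonneg_right ?_ (abs_nonneg _)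
      exact Real.rpow_le_rpow_of_exponent_ge ht.1 ht.2 (by have := min_le_left (2 * ε) 1; linarith)
  have hq1 : IntegrableOn q (Ioi 1) := by
    refine (integrable_norm_iff (hm' _ (Ioi_subset_Ioi zero_le_one))).1 ?_
    exact h2
  have hq0 : ∀ r, 0 < r → IntegrableOn q (Ioc r 1) := by
    intro r hr
    refine Integrable.mono' (g := fun t => r ^ (-(1 - δ)) * (t ^ (1 - δ) * |q t|))
      ((hint'.mono_set (Ioc_subset_Ioc_left hr.le)).const_mul _)
      (hm' _ fun t ht => hr.trans ht.1) ?_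
    filter_upwards [ae_restrict_mem measurableSet_Ioc] with t ht
    rw [← mul_assoc, Real.norm_eq_abs]
    refine le_mul_of_one_le_left (abs_nonneg _) ?_
    rw [Real.rpow_neg hr.le, inv_mul_eq_div, one_le_div (Real.rpow_pos_of_pos hr _)]
    exact Real.rpow_le_rpow hr.le ht.1.le (by linarith)
  have hqI : ∀ r, 0 < r → IntegrableOn q (Ioi r) := by
    intro r hr
    refine ((hq0 r hr).union hq1).mono_set fun t ht => ?_
    rcases le_or_gt t 1 with h | h
    · exact Or.inl ⟨ht, h⟩
    · exact Or.inr h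
  refine ⟨δ, C, hC, hc, hδ0, hδ1, hm, fun r hr => ?_, hqI⟩
  have hunit : IntervalIntegrable (fun t => t ^ (1 - δ) * |q t|) volume 0 r := by
    refine IntervalIntegrable.trans (b := 1) ?_ ?_
    · rwa [intervalIntegrable_iff_integrableOn_Ioc_of_le zero_le_one]
    · refine IntervalIntegrable.continuousOn_mul
        (intervalIntegrable_of_integrableOn_Ioi hqI one_pos hr).abs
        ((continuousOn_rpow_const_Ioi _).mono fun t ht => ?_)
      exact lt_of_lt_of_le (lt_min one_pos hr) ht.1
  have hpow : IntervalIntegrable (fun t : ℝ => t ^ (1 - δ)) volume 0 r :=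
    intervalIntegral.intervalIntegrable_rpow' (by linarith)
  have hsum := hunit.add hpow
  rw [intervalIntegrable_iff_integrableOn_Ioc_of_le hr.le] at hsum ⊢
  refine Integrable.mono' hsum ?_ ?_
  · exact (((continuousOn_rpow_const_Ioi _).mono Ioc_subset_Ioi_self).aestronglyMeasurable
      measurableSet_Ioc).mul ((hm' _ Ioc_subset_Ioi_self).sub aestronglyMeasurable_const).norm
  · filter_upwards [ae_restrict_mem measurableSet_Ioc] with t ht
    have h0 : 0 ≤ t ^ (1 - δ) := Real.rpow_nonneg ht.1.le _
    rw [Real.norm_of_nonneg (mul_nonneg h0 (abs_nonneg _))]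
    calc t ^ (1 - δ) * |q t - 1| ≤ t ^ (1 - δ) * (|q t| + 1) := by
          refine mul_le_mul_of_nonneg_left ?_ h0
          simpa using abs_sub (q t) 1
      _ = _ := by
          change _ = t ^ (1 - δ) * |q t| + t ^ (1 - δ)
          ring

end Potential

/-! ### First-order form, Wronskians and bases of solutions. -/

section Solutions

variable {q : ℝ → ℝ} {ν : ℂ} {u w : ℝ → ℂ}

theorem IsRadialSolution.hasDerivAt (hu : IsRadialSolution q ν u) {r : ℝ} (hr : 0 < r) :
    HasDerivAt u (deriv u r) r :=
  ((hu.contDiffOn.differentiableOn one_ne_zero).differentiableAt (Ioi_mem_nhds hr)).hasDerivAt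

theorem IsRadialSolution.continuousOn (hu : IsRadialSolution q ν u) : ContinuousOn u (Ioi 0) :=
  hu.contDiffOn.continuousOn

theorem IsRadialSolution.continuousOn_deriv (hu : IsRadialSolution q ν u) :
    ContinuousOn (deriv u) (Ioi 0) :=
  hu.contDiffOn.continuousOn_deriv_of_isOpen isOpen_Ioi le_rfl

theorem IsRadialSolution.hasDerivAt_deriv (hu : IsRadialSolution q ν u) {r : ℝ} (hr : 0 < r)
    (hc : ContinuousAt q r) :
    HasDerivAt (deriv u) (((ν ^ 2 - 1 / 4) / (r : ℂ) ^ 2 + (q r : ℂ) - 1) * u r) r := by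
  refine (hu.differentiableAt r hr hc).hasDerivAt.congr_deriv ?_
  linear_combination -(hu.equation r hr hc)

theorem IsRadialSolution.of_hasDerivAt (h1 : ∀ r, 0 < r → HasDerivAt u (w r) r)
    (hw : ContinuousOn w (Ioi 0))
    (h2 : ∀ r, 0 < r → ContinuousAt q r →
      HasDerivAt w (((ν ^ 2 - 1 / 4) / (r : ℂ) ^ 2 + (q r : ℂ) - 1) * u r) r) :
    IsRadialSolution q ν u := by
  have hd : ∀ r, 0 < r → deriv u r = w r := fun r hr => (h1 r hr).deriv
  have h3 : ∀ r, 0 < r → ContinuousAt q r → HasDerivAt (deriv u)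
      (((ν ^ 2 - 1 / 4) / (r : ℂ) ^ 2 + (q r : ℂ) - 1) * u r) r := by
    intro r hr hc
    refine (h2 r hr hc).congr_of_eventuallyEq ?_
    filter_upwards [Ioi_mem_nhds hr] with x hx using hd x hx
  refine ⟨?_, fun r hr hc => (h3 r hr hc).differentiableAt, fun r hr hc => ?_⟩
  · have := (contDiffOn_succ_iff_deriv_of_isOpen (𝕜 := ℝ) (n := 0) (f := u)
      (isOpen_Ioi (a := (0 : ℝ)))).2
      ⟨fun r hr => (h1 r hr).differentiableAt.differentiableWithinAt, by simp,
        contDiffOn_zero.2 (hw.congr fun r hr => hd r hr)⟩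
    simpa using this
  · rw [(h3 r hr hc).deriv]
    ring

/-- The Wronskian of two functions. -/
def wronskian (u w : ℝ → ℂ) (r : ℝ) : ℂ := u r * deriv w r - deriv u r * w r

variable {δ : ℝ} {C : Set ℝ}

/-- The equation gives derivative zero only where `q` is continuous. Continuity of the Wronskian and
countability of the exceptional set extend this to the whole half-line. -/
theorem Admissible.wronskian_eq (A : Admissible q δ C) (hu : IsRadialSolution q ν u)
    (hw : IsRadialSolution q ν w) {r s : ℝ} (hr : 0 < r) (hs : 0 < s) :
    wronskian u w r = wronskian u w s := by
  have hd : ∀ r, 0 < r → HasDerivAt (wronskian u w) 0 r := by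
    intro r hr
    refine hasDerivAt_of_off_countable (g := fun _ => 0) A.countable
      ((hu.continuousOn.mul hw.continuousOn_deriv).sub
        (hu.continuousOn_deriv.mul hw.continuousOn)) continuousOn_const (fun x hx hxC => ?_) hr
    have hc := A.continuousAt x hx hxC
    refine (((hu.hasDerivAt hx).mul (hw.hasDerivAt_deriv hx hc)).sub
      ((hu.hasDerivAt_deriv hx hc).mul (hw.hasDerivAt hx))).congr_deriv ?_
    ring
  exact isOpen_Ioi.is_const_of_deriv_eq_zero isPreconnected_Ioi
    (fun r hr => (hd r hr).differentiableAt.differentiableWithinAt)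
    (fun r hr => (hd r hr).deriv) hr hs

/-- Two solutions with nonvanishing Wronskian span the space of solutions. -/
theorem Admissible.exists_eq_combination (A : Admissible q δ C) {f g : ℝ → ℂ}
    (hu : IsRadialSolution q ν u) (hf : IsRadialSolution q ν f) (hg : IsRadialSolution q ν g)
    (hfg : wronskian f g 1 ≠ 0) :
    ∃ a b : ℂ, ∀ r, 0 < r → u r = a * f r + b * g r := by
  -- Cramer's rule. The coefficients are constants because Wronskians are, so at each `r` they may
  -- be evaluated at that same `r`, where the claim is an algebraic identity.
  refine ⟨wronskian u g 1 / wronskian f g 1, -wronskian u f 1 / wronskian f g 1, fun r hr => ?_⟩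
  have h1 := A.wronskian_eq hf hg one_pos hr
  have h2 := A.wronskian_eq hu hg one_pos hr
  have h3 := A.wronskian_eq hu hf one_pos hr
  field_simp
  rw [h1, h2, h3]
  simp only [wronskian]
  ring

end Solutions

/-! ### Construction of the regular solution. -/

section Regular

theorem hasDerivAt_ofReal_cpow {x : ℝ} (hx : 0 < x) (p : ℂ) :
    HasDerivAt (fun y : ℝ => (y : ℂ) ^ p) (p * (x : ℂ) ^ (p - 1)) x := by
  by_cases hp : p = 0
  · subst hp
    simpa using hasDerivAt_const x (1 : ℂ)
  · exact hasDerivAt_ofReal_cpow_const hx.ne' hp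

theorem continuousOn_ofReal_cpow (p : ℂ) : ContinuousOn (fun y : ℝ => (y : ℂ) ^ p) (Ioi 0) :=
  fun _ hx => (hasDerivAt_ofReal_cpow hx p).continuousAt.continuousWithinAt

theorem ofReal_ne_zero_of_pos {x : ℝ} (hx : 0 < x) : (x : ℂ) ≠ 0 :=
  Complex.ofReal_ne_zero.2 hx.ne'

theorem ofReal_cpow_ne_zero {x : ℝ} (hx : 0 < x) (p : ℂ) : (x : ℂ) ^ p ≠ 0 := by
  simp [Complex.cpow_eq_zero_iff, hx.ne']

variable {q : ℝ → ℝ} {ν : ℂ} {δ : ℝ} {C : Set ℝ}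

/-- The integrable function that controls the Volterra equation of the regular solution. -/
def regularMajorant (q : ℝ → ℝ) (δ t : ℝ) : ℝ := t ^ (1 - δ) * |q t - 1| + t ^ (δ - 1)

theorem regularMajorant_nonneg (q : ℝ → ℝ) (δ : ℝ) {t : ℝ} (ht : 0 < t) :
    0 ≤ regularMajorant q δ t :=
  add_nonneg (mul_nonneg (Real.rpow_nonneg ht.le _) (abs_nonneg _)) (Real.rpow_nonneg ht.le _)

theorem Admissible.intervalIntegrable_majorant (A : Admissible q δ C) {r : ℝ} (hr : 0 < r) :
    IntervalIntegrable (regularMajorant q δ) volume 0 r :=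
  (A.intervalIntegrable_zero r hr).add
    (intervalIntegral.intervalIntegrable_rpow' (by linarith [A.pos]))

theorem Admissible.continuousAt_majorant (A : Admissible q δ C) {r : ℝ} (hr : 0 < r)
    (hrC : r ∉ C) : ContinuousAt (regularMajorant q δ) r := by
  have h : ∀ p : ℝ, ContinuousAt (fun t : ℝ => t ^ p) r := fun p =>
    Real.continuousAt_rpow_const r p (Or.inl hr.ne')
  exact ((h _).mul ((A.continuousAt r hr hrC).sub continuousAt_const).abs).add (h _)

/-- The weight of the Volterra equation of the regular solution. -/
def regularWeight (q : ℝ → ℝ) (δ : ℝ) : ℝ → ℝ := weightZero (regularMajorant q δ)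

/-- The integrand of the inner Volterra integral. -/
def innerIntegrand (q : ℝ → ℝ) (ν : ℂ) (y : ℝ → ℂ) (t : ℝ) : ℂ :=
  (t : ℂ) ^ (2 * ν + 1) * ((q t : ℂ) - 1) * y t

/-- The integrand of the outer Volterra integral. -/
def outerIntegrand (q : ℝ → ℝ) (ν : ℂ) (y : ℝ → ℂ) (s : ℝ) : ℂ :=
  (s : ℂ) ^ (-(2 * ν + 1)) * ∫ t in (0 : ℝ)..s, innerIntegrand q ν y t

/-- The power is split as `t ^ (2 Re ν + δ) * t ^ (1 - δ)`: the first factor increases and is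
replaced by its value at `s`, the second makes `|q - 1|` integrable at the origin. -/
theorem norm_innerIntegrand_le {y : ℝ → ℂ} {M : ℝ} (hν : 0 ≤ ν.re) (hδ : 0 < δ)
    (hy : ∀ r, 0 < r → ‖y r‖ ≤ M * regularWeight q δ r) {t s : ℝ} (ht : 0 < t) (hts : t ≤ s) :
    ‖innerIntegrand q ν y t‖ ≤
      s ^ (2 * ν.re + δ) * M * (regularMajorant q δ t * regularWeight q δ t) := by
  have h1 : ‖innerIntegrand q ν y t‖ = t ^ (2 * ν.re + 1) * |q t - 1| * ‖y t‖ := by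
    rw [innerIntegrand, norm_mul, norm_mul, Complex.norm_cpow_eq_rpow_re_of_pos ht]
    congr 2
    · simp
    · rw [← Complex.ofReal_one, ← Complex.ofReal_sub, Complex.norm_real, Real.norm_eq_abs]
  have h2 : t ^ (2 * ν.re + 1) = t ^ (2 * ν.re + δ) * t ^ (1 - δ) := by
    rw [← Real.rpow_add ht]; ring_nf
  have h3 : t ^ (2 * ν.re + δ) ≤ s ^ (2 * ν.re + δ) := Real.rpow_le_rpow ht.le hts (by positivity)
  have h4 : t ^ (1 - δ) * |q t - 1| ≤ regularMajorant q δ t :=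
    le_add_of_nonneg_right (Real.rpow_nonneg ht.le _)
  rw [h1, h2, mul_assoc (t ^ (2 * ν.re + δ))]
  calc _ ≤ s ^ (2 * ν.re + δ) * regularMajorant q δ t * (M * regularWeight q δ t) := by
        refine mul_le_mul (mul_le_mul h3 h4 ?_ ?_) (hy t ht) (norm_nonneg _) ?_
        · exact mul_nonneg (Real.rpow_nonneg ht.le _) (abs_nonneg _)
        · exact Real.rpow_nonneg (ht.le.trans hts) _
        · exact mul_nonneg (Real.rpow_nonneg (ht.le.trans hts) _) (regularMajorant_nonneg _ _ ht)
    _ = _ := by ring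

theorem Admissible.intervalIntegrable_inner (A : Admissible q δ C) (hν : 0 ≤ ν.re) {y : ℝ → ℂ}
    (hy : WeightedBounded (regularWeight q δ) y) {r : ℝ} (hr : 0 < r) :
    IntervalIntegrable (innerIntegrand q ν y) volume 0 r := by
  obtain ⟨hyc, M, hM⟩ := hy
  have hb := (intervalIntegrable_mul_weightZero (fun r hr => A.intervalIntegrable_majorant hr)
    hr).const_mul (r ^ (2 * ν.re + δ) * M)
  rw [intervalIntegrable_iff_integrableOn_Ioc_of_le hr.le] at hb ⊢
  refine Integrable.mono' hb ?_ ?_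
  · have hq := A.aestronglyMeasurable.mono_measure
      (Measure.restrict_mono (show Ioc 0 r ⊆ Ioi 0 from Ioc_subset_Ioi_self) le_rfl)
    exact ((((continuousOn_ofReal_cpow _).mono Ioc_subset_Ioi_self).aestronglyMeasurable
      measurableSet_Ioc).mul ((Complex.continuous_ofReal.comp_aestronglyMeasurable hq).sub
      aestronglyMeasurable_const)).mul
      ((hyc.mono Ioc_subset_Ioi_self).aestronglyMeasurable measurableSet_Ioc)
  · filter_upwards [ae_restrict_mem measurableSet_Ioc] with t ht
    exact norm_innerIntegrand_le hν A.pos hM ht.1 ht.2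

theorem Admissible.norm_inner_le (A : Admissible q δ C) (hν : 0 ≤ ν.re) {y : ℝ → ℂ} {M : ℝ}
    (hM : ∀ r, 0 < r → ‖y r‖ ≤ M * regularWeight q δ r) {s : ℝ} (hs : 0 < s) :
    ‖∫ t in (0 : ℝ)..s, innerIntegrand q ν y t‖ ≤
      s ^ (2 * ν.re + δ) * M * (regularWeight q δ s / 2) := by
  have hint : ∀ r, 0 < r → IntervalIntegrable (regularMajorant q δ) volume 0 r :=
    fun r hr => A.intervalIntegrable_majorant hr
  have hM0 : 0 ≤ M := by
    have := (norm_nonneg _).trans (hM s hs)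
    exact nonneg_of_mul_nonneg_left this (Real.exp_pos _)
  refine (intervalIntegral.norm_integral_le_of_norm_le hs.le (Eventually.of_forall fun t ht =>
    norm_innerIntegrand_le hν A.pos hM ht.1 ht.2)
    ((intervalIntegrable_mul_weightZero hint hs).const_mul _)).trans ?_
  rw [intervalIntegral.integral_const_mul]
  exact mul_le_mul_of_nonneg_left (integral_mul_weightZero_le A.countable hint
    (fun r hr hrC => A.continuousAt_majorant hr hrC) hs)
    (mul_nonneg (Real.rpow_nonneg hs.le _) hM0)

/-- The power of `s` gained from the inner integral combines with the outer one to `s ^ (δ - 1)`,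
integrable at the origin because `δ > 0`. This is why `regularMajorant` contains that term. -/
theorem Admissible.norm_outerIntegrand_le (A : Admissible q δ C) (hν : 0 ≤ ν.re) {y : ℝ → ℂ}
    {M : ℝ} (hM : ∀ r, 0 < r → ‖y r‖ ≤ M * regularWeight q δ r) {s : ℝ} (hs : 0 < s) :
    ‖outerIntegrand q ν y s‖ ≤ M / 2 * (regularMajorant q δ s * regularWeight q δ s) := by
  have hM0 : 0 ≤ M := by
    have := (norm_nonneg _).trans (hM s hs)
    exact nonneg_of_mul_nonneg_left this (Real.exp_pos _)
  have hω : 0 < regularWeight q δ s := Real.exp_pos _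
  rw [outerIntegrand, norm_mul, Complex.norm_cpow_eq_rpow_re_of_pos hs]
  have h1 : (-(2 * ν + 1)).re = -(2 * ν.re + 1) := by simp
  rw [h1]
  have h2 : s ^ (-(2 * ν.re + 1)) * s ^ (2 * ν.re + δ) = s ^ (δ - 1) := by
    rw [← Real.rpow_add hs]; ring_nf
  calc _ ≤ s ^ (-(2 * ν.re + 1)) * (s ^ (2 * ν.re + δ) * M * (regularWeight q δ s / 2)) :=
        mul_le_mul_of_nonneg_left (A.norm_inner_le hν hM hs) (Real.rpow_nonneg hs.le _)
    _ = M / 2 * (s ^ (δ - 1) * regularWeight q δ s) := by rw [← h2]; ring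
    _ ≤ _ := by
        refine mul_le_mul_of_nonneg_left (mul_le_mul_of_nonneg_right ?_ hω.le) (by positivity)
        exact le_add_of_nonneg_left (mul_nonneg (Real.rpow_nonneg hs.le _) (abs_nonneg _))

theorem Admissible.continuousOn_outerIntegrand (A : Admissible q δ C) (hν : 0 ≤ ν.re) {y : ℝ → ℂ}
    (hy : WeightedBounded (regularWeight q δ) y) : ContinuousOn (outerIntegrand q ν y) (Ioi 0) :=
  (continuousOn_ofReal_cpow _).mul ((continuousOn_primitive_zero fun _ hr =>
    A.intervalIntegrable_inner hν hy hr).mono Ioi_subset_Ici_self)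

theorem Admissible.intervalIntegrable_outer (A : Admissible q δ C) (hν : 0 ≤ ν.re) {y : ℝ → ℂ}
    (hy : WeightedBounded (regularWeight q δ) y) {r : ℝ} (hr : 0 < r) :
    IntervalIntegrable (outerIntegrand q ν y) volume 0 r := by
  have hc := A.continuousOn_outerIntegrand hν hy
  obtain ⟨hyc, M, hM⟩ := hy
  have hb := (intervalIntegrable_mul_weightZero (fun r hr => A.intervalIntegrable_majorant hr)
    hr).const_mul (M / 2)
  rw [intervalIntegrable_iff_integrableOn_Ioc_of_le hr.le] at hb ⊢
  refine Integrable.mono' hb ((hc.mono Ioc_subset_Ioi_self).aestronglyMeasurable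
    measurableSet_Ioc) ?_
  filter_upwards [ae_restrict_mem measurableSet_Ioc] with t ht
  exact A.norm_outerIntegrand_le hν hM ht.1

/-- For `φ = r ^ (ν + 1/2) v` the radial equation reads `(r ^ (2ν + 1) v')' = r ^ (2ν + 1) (q - 1)
v`. Integrating twice from the origin, with `v → 1` and `r ^ (2ν + 1) v' → 0`, gives this equation.
-/
theorem Admissible.exists_volterra_regular (A : Admissible q δ C) (hν : 0 ≤ ν.re) :
    ∃ v, WeightedBounded (regularWeight q δ) v ∧
      ∀ r, 0 < r → v r = 1 + ∫ s in (0 : ℝ)..r, outerIntegrand q ν v s := by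
  have hint : ∀ r, 0 < r → IntervalIntegrable (regularMajorant q δ) volume 0 r :=
    fun r hr => A.intervalIntegrable_majorant hr
  refine exists_weighted_fixedPoint (y₀ := fun _ => 1)
    ((continuousOn_weightZero hint).mono Ioi_subset_Ici_self) (fun r _ => Real.exp_pos _)
    (fun y r => ∫ s in (0 : ℝ)..r, outerIntegrand q ν y s) ?_ ?_ ?_ ⟨continuousOn_const, 1, ?_⟩
  · intro y hy
    exact (continuousOn_primitive_zero fun r hr => A.intervalIntegrable_outer hν hy hr).mono
      Ioi_subset_Ici_self
  · intro y z hy hz r hr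
    rw [← intervalIntegral.integral_sub (A.intervalIntegrable_outer hν hy hr)
      (A.intervalIntegrable_outer hν hz hr)]
    rw [intervalIntegral.integral_of_le hr.le, intervalIntegral.integral_of_le hr.le]
    refine setIntegral_congr_fun measurableSet_Ioc fun s hs => ?_
    simp only [outerIntegrand]
    rw [← mul_sub, ← intervalIntegral.integral_sub (A.intervalIntegrable_inner hν hy hs.1)
      (A.intervalIntegrable_inner hν hz hs.1)]
    congr 2
    funext t
    simp only [innerIntegrand, Pi.sub_apply]
    ring
  · intro y M _ hM r hr
    have hM0 : 0 ≤ M := by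
      have := (norm_nonneg _).trans (hM r hr)
      exact nonneg_of_mul_nonneg_left this (Real.exp_pos _)
    refine (intervalIntegral.norm_integral_le_of_norm_le hr.le (Eventually.of_forall fun t ht =>
      A.norm_outerIntegrand_le hν hM ht.1)
      ((intervalIntegrable_mul_weightZero hint hr).const_mul _)).trans ?_
    rw [intervalIntegral.integral_const_mul]
    refine mul_le_mul_of_nonneg_left ((integral_mul_weightZero_le A.countable hint
      (fun r hr hrC => A.continuousAt_majorant hr hrC) hr).trans ?_) (by positivity)
    exact half_le_self (Real.exp_pos _).le
  · intro r hr
    simpa using one_le_weightZero (fun r hr => regularMajorant_nonneg q δ hr) hr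

/-- `r ^ (2ν + 1) (d/dr) (r ^ (-ν - 1/2) u)`, the quantity that vanishes at the origin for the
regular solution. -/
def quasiDeriv (ν : ℂ) (u : ℝ → ℂ) (r : ℝ) : ℂ :=
  (r : ℂ) ^ (ν + 1 / 2) * deriv u r - (ν + 1 / 2) * (r : ℂ) ^ (ν - 1 / 2) * u r

/-- The amplitude `r ^ (-ν - 1/2) u`. -/
def amplitude (ν : ℂ) (u : ℝ → ℂ) (r : ℝ) : ℂ := (r : ℂ) ^ (-(ν + 1 / 2)) * u r

theorem isEquivalent_cpow_iff {u : ℝ → ℂ} :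
    Asymptotics.IsEquivalent (𝓝[>] (0 : ℝ)) u (fun r : ℝ => (r : ℂ) ^ (ν + 1 / 2)) ↔
      Tendsto (amplitude ν u) (𝓝[>] 0) (𝓝 1) := by
  rw [Asymptotics.isEquivalent_iff_tendsto_one]
  · refine tendsto_congr' ?_
    filter_upwards [self_mem_nhdsWithin] with r hr
    rw [Pi.div_apply, amplitude, Complex.cpow_neg]
    ring
  · filter_upwards [self_mem_nhdsWithin] with r hr using ofReal_cpow_ne_zero hr _

theorem Admissible.exists_regular (A : Admissible q δ C) (hν : 0 ≤ ν.re) :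
    ∃ φ, IsRegularSolution q ν φ ∧ Tendsto (quasiDeriv ν φ) (𝓝[>] 0) (𝓝 0) := by
  obtain ⟨v, hv, hveq⟩ := A.exists_volterra_regular hν
  set I : ℝ → ℂ := fun s => ∫ t in (0 : ℝ)..s, innerIntegrand q ν v t with hI
  have hinner : ∀ r, 0 < r → IntervalIntegrable (innerIntegrand q ν v) volume 0 r :=
    fun r hr => A.intervalIntegrable_inner hν hv hr
  have houter : ∀ r, 0 < r → IntervalIntegrable (outerIntegrand q ν v) volume 0 r :=
    fun r hr => A.intervalIntegrable_outer hν hv hr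
  have hvd : ∀ r : ℝ, 0 < r → HasDerivAt v ((r : ℂ) ^ (-(2 * ν + 1)) * I r) r := by
    intro r hr
    refine ((hasDerivAt_primitive_zero houter hr ((A.continuousOn_outerIntegrand hν hv).continuousAt
      (Ioi_mem_nhds hr))).const_add 1).congr_of_eventuallyEq ?_
    filter_upwards [Ioi_mem_nhds hr] with x hx using hveq x hx
  have hId : ∀ r, 0 < r → ContinuousAt q r → HasDerivAt I (innerIntegrand q ν v r) r := by
    intro r hr hc
    refine hasDerivAt_primitive_zero hinner hr ?_
    exact (((continuousOn_ofReal_cpow _).continuousAt (Ioi_mem_nhds hr)).mul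
      ((Complex.continuous_ofReal.continuousAt.comp hc).sub continuousAt_const)).mul
      (hv.1.continuousAt (Ioi_mem_nhds hr))
  have hIc : ContinuousOn I (Ioi 0) := (continuousOn_primitive_zero hinner).mono Ioi_subset_Ici_self
  set a : ℂ := ν + 1 / 2 with ha
  set φ : ℝ → ℂ := fun r => (r : ℂ) ^ a * v r with hφ
  -- The candidate for `φ'`: as `2a = 2ν + 1`, the term `r ^ a * v'` equals `r ^ (-a) * I`.
  set ψ : ℝ → ℂ := fun r => a * (r : ℂ) ^ (a - 1) * v r + (r : ℂ) ^ (-a) * I r with hψ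
  have hφd : ∀ r, 0 < r → HasDerivAt φ (ψ r) r := by
    intro r hr
    refine ((hasDerivAt_ofReal_cpow hr a).mul (hvd r hr)).congr_deriv ?_
    have : (r : ℂ) ^ (-a) = (r : ℂ) ^ a * (r : ℂ) ^ (-(2 * ν + 1)) := by
      rw [← Complex.cpow_add _ _ (ofReal_ne_zero_of_pos hr)]
      congr 1; rw [ha]; ring
    rw [hψ]
    simp only [this]
    ring
  have hψc : ContinuousOn ψ (Ioi 0) :=
    ((continuousOn_const.mul (continuousOn_ofReal_cpow _)).mul hv.1).add
      ((continuousOn_ofReal_cpow _).mul hIc)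
  have hsol : IsRadialSolution q ν φ := by
    refine IsRadialSolution.of_hasDerivAt hφd hψc fun r hr hc => ?_
    have hr0 := ofReal_ne_zero_of_pos hr
    refine ((((hasDerivAt_ofReal_cpow hr (a - 1)).const_mul a).mul (hvd r hr)).add
      ((hasDerivAt_ofReal_cpow hr (-a)).mul (hId r hr hc))).congr_deriv ?_
    have e1 : (r : ℂ) ^ (a - 1 - 1) = (r : ℂ) ^ a / (r : ℂ) ^ 2 := by
      rw [Complex.cpow_sub _ _ hr0, Complex.cpow_sub _ _ hr0, Complex.cpow_one]
      field_simp
    have e2 : (r : ℂ) ^ (-a - 1) = (r : ℂ) ^ (a - 1) * (r : ℂ) ^ (-(2 * ν + 1)) := by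
      rw [← Complex.cpow_add _ _ hr0]
      congr 1; rw [ha]; ring
    have e3 : (r : ℂ) ^ (-a) * (r : ℂ) ^ (2 * ν + 1) = (r : ℂ) ^ a := by
      rw [← Complex.cpow_add _ _ hr0]
      congr 1; rw [ha]; ring
    simp only [innerIntegrand, hφ]
    rw [e1, e2]
    have e4 : a * (a - 1) = ν ^ 2 - 1 / 4 := by rw [ha]; ring
    rw [← e4, ← e3]
    field_simp
    ring
  refine ⟨φ, ⟨hsol, isEquivalent_cpow_iff.2 ?_⟩, ?_⟩
  · have h1 : Tendsto (fun r => 1 + ∫ s in (0 : ℝ)..r, outerIntegrand q ν v s) (𝓝[>] 0)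
        (𝓝 (1 + 0)) := tendsto_const_nhds.add (tendsto_primitive_zero houter)
    rw [add_zero] at h1
    refine h1.congr' ?_
    filter_upwards [self_mem_nhdsWithin] with r hr
    rw [← hveq r hr, amplitude, hφ, ← mul_assoc, ← Complex.cpow_add _ _ (ofReal_ne_zero_of_pos hr)]
    simp [ha]
  -- The quasi-derivative of `φ` is exactly the inner integral `I`, which vanishes at the origin.
  · refine (tendsto_primitive_zero hinner).congr' ?_
    filter_upwards [self_mem_nhdsWithin] with r hr
    have hr0 := ofReal_ne_zero_of_pos hr
    rw [quasiDeriv, (hφd r hr).deriv]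
    have e1 : (r : ℂ) ^ a * (r : ℂ) ^ (-a) = 1 := by
      rw [← Complex.cpow_add _ _ hr0]; simp
    have e2 : ν - 1 / 2 = a - 1 := by rw [ha]; ring
    simp only [hφ, hψ, e2]
    linear_combination -(I r) * e1

end Regular

/-! ### Construction of the Jost solutions and asymptotics of their derivatives. -/

section Jost

variable {q : ℝ → ℝ} {ν : ℂ} {δ : ℝ} {C : Set ℝ}

/-- The effective potential `(ν² - 1/4) / r² + q(r)`. -/
def effectivePotential (q : ℝ → ℝ) (ν : ℂ) (r : ℝ) : ℂ :=
  (ν ^ 2 - 1 / 4) / (r : ℂ) ^ 2 + (q r : ℂ)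

theorem Admissible.integrableOn_effectivePotential (A : Admissible q δ C) (ν : ℂ) {r : ℝ}
    (hr : 0 < r) : IntegrableOn (effectivePotential q ν) (Ioi r) := by
  refine Integrable.add ?_ (A.integrableOn_Ioi r hr).ofReal
  have h := ((integrableOn_Ioi_rpow_of_lt (a := -2) (by norm_num) hr).ofReal
    (𝕜 := ℂ)).const_mul (ν ^ 2 - 1 / 4)
  refine (integrable_congr ?_).1 h
  filter_upwards [ae_restrict_mem measurableSet_Ioi] with t ht
  have ht0 : 0 < t := hr.trans ht
  simp [Real.rpow_neg ht0.le, div_eq_mul_inv]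

theorem continuousAt_effectivePotential {r : ℝ} (hr : 0 < r) (hc : ContinuousAt q r) :
    ContinuousAt (effectivePotential q ν) r := by
  refine ContinuousAt.add (ContinuousAt.div continuousAt_const ?_ ?_) ?_
  · exact (Complex.continuous_ofReal.pow 2).continuousAt
  · exact pow_ne_zero 2 (ofReal_ne_zero_of_pos hr)
  · exact Complex.continuous_ofReal.continuousAt.comp hc

/-- The weight of the Volterra equation of the Jost solutions. -/
def jostWeight (q : ℝ → ℝ) (ν : ℂ) : ℝ → ℝ := weightInfty fun t => ‖effectivePotential q ν t‖

theorem Admissible.integrableOn_mul_jost (A : Admissible q δ C) {y : ℝ → ℂ}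
    (hy : WeightedBounded (jostWeight q ν) y) {g : ℝ → ℝ} (hg : Continuous g)
    (hg1 : ∀ t, |g t| ≤ 1) {r : ℝ} (hr : 0 < r) :
    IntegrableOn (fun t => (g t : ℂ) * effectivePotential q ν t * y t) (Ioi r) := by
  obtain ⟨hyc, M, hM⟩ := hy
  have hV : ∀ r, 0 < r → IntegrableOn (fun t => ‖effectivePotential q ν t‖) (Ioi r) :=
    fun r hr => (A.integrableOn_effectivePotential ν hr).norm
  have hb := (integrableOn_mul_weightInfty hV (fun _ _ => norm_nonneg _) hr).const_mul M
  refine Integrable.mono' hb ?_ ?_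
  · exact ((Complex.continuous_ofReal.comp hg).aestronglyMeasurable.mul
      (A.integrableOn_effectivePotential ν hr).aestronglyMeasurable).mul
      ((hyc.mono (Ioi_subset_Ioi hr.le)).aestronglyMeasurable measurableSet_Ioi)
  · filter_upwards [ae_restrict_mem measurableSet_Ioi] with t ht
    rw [norm_mul, norm_mul, Complex.norm_real, Real.norm_eq_abs]
    calc |g t| * ‖effectivePotential q ν t‖ * ‖y t‖
        ≤ 1 * ‖effectivePotential q ν t‖ * (M * jostWeight q ν t) :=
          mul_le_mul (mul_le_mul_of_nonneg_right (hg1 t) (norm_nonneg _)) (hM t (hr.trans ht))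
            (norm_nonneg _) (by positivity)
      _ = _ := by rw [jostWeight]; ring

/-- The moment `∫_r^∞ g (V y)` for the effective potential `V`. -/
def jostMoment (q : ℝ → ℝ) (ν : ℂ) (g : ℝ → ℝ) (y : ℝ → ℂ) (r : ℝ) : ℂ :=
  ∫ t in Ioi r, (g t : ℂ) * effectivePotential q ν t * y t

/-- The Volterra operator `y ↦ ∫_r^∞ sin (t - r) V(t) y(t) dt` of the Jost solutions. -/
def jostVolterra (q : ℝ → ℝ) (ν : ℂ) (y : ℝ → ℂ) (r : ℝ) : ℂ :=
  (Real.cos r : ℂ) * jostMoment q ν Real.sin y r - (Real.sin r : ℂ) * jostMoment q ν Real.cos y r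

/-- The separated form is the one to differentiate; the kernel form is the one to estimate. With the
single kernel `sin (t - r)`, bounded by `1`, the norm halves, while bounding the two separated terms
one by one would lose a factor `2` and the contraction. -/
theorem Admissible.jostVolterra_eq (A : Admissible q δ C) {y : ℝ → ℂ}
    (hy : WeightedBounded (jostWeight q ν) y) {r : ℝ} (hr : 0 < r) :
    jostVolterra q ν y r = jostMoment q ν (fun t => Real.sin (t - r)) y r := by
  simp only [jostVolterra, jostMoment]
  rw [← integral_const_mul, ← integral_const_mul, ← integral_sub
    ((A.integrableOn_mul_jost hy Real.continuous_sin Real.abs_sin_le_one hr).const_mul _)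
    ((A.integrableOn_mul_jost hy Real.continuous_cos Real.abs_cos_le_one hr).const_mul _)]
  congr 1
  funext t
  rw [Real.sin_sub]
  push_cast
  ring

theorem Admissible.jostMoment_sub (A : Admissible q δ C) {y z : ℝ → ℂ}
    (hy : WeightedBounded (jostWeight q ν) y) (hz : WeightedBounded (jostWeight q ν) z)
    {g : ℝ → ℝ} (hg : Continuous g) (hg1 : ∀ t, |g t| ≤ 1) {r : ℝ} (hr : 0 < r) :
    jostMoment q ν g y r - jostMoment q ν g z r = jostMoment q ν g (y - z) r := by
  simp only [jostMoment]
  rw [← integral_sub (A.integrableOn_mul_jost hy hg hg1 hr) (A.integrableOn_mul_jost hz hg hg1 hr)]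
  congr 1
  funext t
  simp only [Pi.sub_apply]
  ring

theorem Admissible.norm_jostMoment_le (A : Admissible q δ C) {y : ℝ → ℂ} {M : ℝ}
    (hM : ∀ r, 0 < r → ‖y r‖ ≤ M * jostWeight q ν r)
    {g : ℝ → ℝ} (hg1 : ∀ t, |g t| ≤ 1) {r : ℝ} (hr : 0 < r) :
    ‖jostMoment q ν g y r‖ ≤ M / 2 * jostWeight q ν r := by
  have hV : ∀ r, 0 < r → IntegrableOn (fun t => ‖effectivePotential q ν t‖) (Ioi r) :=
    fun r hr => (A.integrableOn_effectivePotential ν hr).norm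
  have hM0 : 0 ≤ M := by
    have := (norm_nonneg _).trans (hM r hr)
    exact nonneg_of_mul_nonneg_left this (Real.exp_pos _)
  have hb := (integrableOn_mul_weightInfty hV (fun _ _ => norm_nonneg _) hr).const_mul M
  refine (norm_integral_le_of_norm_le hb ?_).trans ?_
  · filter_upwards [ae_restrict_mem measurableSet_Ioi] with t ht
    rw [norm_mul, norm_mul, Complex.norm_real, Real.norm_eq_abs]
    calc |g t| * ‖effectivePotential q ν t‖ * ‖y t‖
        ≤ 1 * ‖effectivePotential q ν t‖ * (M * jostWeight q ν t) :=
          mul_le_mul (mul_le_mul_of_nonneg_right (hg1 t) (norm_nonneg _)) (hM t (hr.trans ht))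
            (norm_nonneg _) (by positivity)
      _ = _ := by rw [jostWeight]; ring
  · rw [integral_const_mul]
    refine (mul_le_mul_of_nonneg_left (integral_mul_weightInfty_le A.countable hV
      (fun _ _ => norm_nonneg _)
      (fun r hr hrC => (continuousAt_effectivePotential hr (A.continuousAt r hr hrC)).norm) hr)
      hM0).trans (le_of_eq ?_)
    rw [jostWeight]; ring

/-- The free wave `exp (s i r)`. -/
def freeWave (s : ℂ) (r : ℝ) : ℂ := Complex.exp (s * Complex.I * (r : ℂ))

theorem continuous_freeWave (s : ℂ) : Continuous (freeWave s) :=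
  Complex.continuous_exp.comp (continuous_const.mul Complex.continuous_ofReal)

theorem norm_freeWave {s : ℂ} (hs : s.im = 0) (r : ℝ) : ‖freeWave s r‖ = 1 := by
  rw [freeWave, Complex.norm_exp]
  simp [hs]

theorem hasDerivAt_freeWave (s : ℂ) (r : ℝ) :
    HasDerivAt (freeWave s) (s * Complex.I * freeWave s r) r := by
  refine (((Complex.ofRealCLM.hasDerivAt (x := r)).const_mul (s * Complex.I)).cexp).congr_deriv ?_
  simp only [freeWave, Complex.ofRealCLM_apply, Complex.ofReal_one]
  ring

theorem Admissible.exists_volterra_jost (A : Admissible q δ C) (ν : ℂ) {s : ℂ} (hs : s.im = 0) :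
    ∃ f, WeightedBounded (jostWeight q ν) f ∧
      ∀ r, 0 < r → f r = freeWave s r + jostVolterra q ν f r := by
  have hV : ∀ r, 0 < r → IntegrableOn (fun t => ‖effectivePotential q ν t‖) (Ioi r) :=
    fun r hr => (A.integrableOn_effectivePotential ν hr).norm
  have hmc : ∀ y, WeightedBounded (jostWeight q ν) y → ∀ g : ℝ → ℝ, Continuous g →
      (∀ t, |g t| ≤ 1) → ContinuousOn (jostMoment q ν g y) (Ioi 0) := fun y hy g hg hg1 =>
    continuousOn_integral_Ioi fun r hr => A.integrableOn_mul_jost hy hg hg1 hr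
  refine exists_weighted_fixedPoint (continuousOn_weightInfty hV) (fun _ _ => Real.exp_pos _)
    (jostVolterra q ν) ?_ ?_ ?_ ⟨(continuous_freeWave s).continuousOn, 1, ?_⟩
  · intro y hy
    exact ((Complex.continuous_ofReal.comp Real.continuous_cos).continuousOn.mul
      (hmc y hy _ Real.continuous_sin Real.abs_sin_le_one)).sub
      ((Complex.continuous_ofReal.comp Real.continuous_sin).continuousOn.mul
      (hmc y hy _ Real.continuous_cos Real.abs_cos_le_one))
  · intro y z hy hz r hr
    simp only [jostVolterra]
    rw [← A.jostMoment_sub hy hz Real.continuous_sin Real.abs_sin_le_one hr,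
      ← A.jostMoment_sub hy hz Real.continuous_cos Real.abs_cos_le_one hr]
    ring
  · intro y M hy hM r hr
    rw [A.jostVolterra_eq hy hr]
    exact A.norm_jostMoment_le hM (fun t => Real.abs_sin_le_one _) hr
  · intro r hr
    rw [norm_freeWave hs, one_mul]
    exact one_le_weightInfty (fun _ _ => norm_nonneg _) hr

/-- The wave has modulus one. The difference form is additive, hence suited to linear combinations
of solutions. -/
theorem tendsto_div_freeWave_iff {s : ℂ} (hs : s.im = 0) {f : ℝ → ℂ} {c : ℂ} :
    Tendsto (fun r => f r / freeWave s r) atTop (𝓝 c) ↔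
      Tendsto (fun r => f r - c * freeWave s r) atTop (𝓝 0) := by
  rw [tendsto_iff_norm_sub_tendsto_zero, tendsto_zero_iff_norm_tendsto_zero (f := fun r => _ - _)]
  refine tendsto_congr fun r => ?_
  have h0 : freeWave s r ≠ 0 := Complex.exp_ne_zero _
  rw [div_sub' h0, norm_div, norm_freeWave hs, div_one, mul_comm c]

theorem isEquivalent_freeWave_iff {s : ℂ} {f : ℝ → ℂ} :
    Asymptotics.IsEquivalent atTop f (fun r : ℝ => Complex.exp (s * Complex.I * (r : ℂ))) ↔
      Tendsto (fun r => f r / freeWave s r) atTop (𝓝 1) :=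
  Asymptotics.isEquivalent_iff_tendsto_one (Eventually.of_forall fun _ => Complex.exp_ne_zero _)

theorem Admissible.exists_jost (A : Admissible q δ C) (ν : ℂ) {s : ℂ} (hs : s.im = 0)
    (hs2 : s ^ 2 = 1) :
    ∃ f, IsJostSolution q ν s f ∧
      Tendsto (fun r => deriv f r / freeWave s r) atTop (𝓝 (s * Complex.I)) := by
  obtain ⟨f, hf, hfeq⟩ := A.exists_volterra_jost ν hs
  set S := jostMoment q ν Real.sin f with hS
  set K := jostMoment q ν Real.cos f with hK
  have hSi : ∀ r, 0 < r → IntegrableOn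
      (fun t => (Real.sin t : ℂ) * effectivePotential q ν t * f t) (Ioi r) :=
    fun r hr => A.integrableOn_mul_jost hf Real.continuous_sin Real.abs_sin_le_one hr
  have hKi : ∀ r, 0 < r → IntegrableOn
      (fun t => (Real.cos t : ℂ) * effectivePotential q ν t * f t) (Ioi r) :=
    fun r hr => A.integrableOn_mul_jost hf Real.continuous_cos Real.abs_cos_le_one hr
  have hSc : ContinuousOn S (Ioi 0) := continuousOn_integral_Ioi hSi
  have hKc : ContinuousOn K (Ioi 0) := continuousOn_integral_Ioi hKi
  have hSt : Tendsto S atTop (𝓝 0) := tendsto_integral_Ioi hSi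
  have hKt : Tendsto K atTop (𝓝 0) := tendsto_integral_Ioi hKi
  have hsinc : Continuous fun r : ℝ => (Real.sin r : ℂ) :=
    Complex.continuous_ofReal.comp Real.continuous_sin
  have hcosc : Continuous fun r : ℝ => (Real.cos r : ℂ) :=
    Complex.continuous_ofReal.comp Real.continuous_cos
  have hSd : ∀ r, 0 < r → ContinuousAt q r →
      HasDerivAt S (-((Real.sin r : ℂ) * effectivePotential q ν r * f r)) r :=
    fun r hr hc => hasDerivAt_integral_Ioi hSi hr ((hsinc.continuousAt.mul
      (continuousAt_effectivePotential hr hc)).mul (hf.1.continuousAt (Ioi_mem_nhds hr)))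
  have hKd : ∀ r, 0 < r → ContinuousAt q r →
      HasDerivAt K (-((Real.cos r : ℂ) * effectivePotential q ν r * f r)) r :=
    fun r hr hc => hasDerivAt_integral_Ioi hKi hr ((hcosc.continuousAt.mul
      (continuousAt_effectivePotential hr hc)).mul (hf.1.continuousAt (Ioi_mem_nhds hr)))
  have hsind : ∀ r : ℝ, HasDerivAt (fun r : ℝ => (Real.sin r : ℂ)) (Real.cos r : ℂ) r :=
    fun r => (Real.hasDerivAt_sin r).ofReal_comp
  have hcosd : ∀ r : ℝ, HasDerivAt (fun r : ℝ => (Real.cos r : ℂ)) (-(Real.sin r : ℂ)) r :=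
    fun r => by simpa using (Real.hasDerivAt_cos r).ofReal_comp
  -- The candidate for `f'`: the contributions of the derivatives of `S` and `K` cancel, so `g`
  -- stays continuous where `q` jumps.
  set g : ℝ → ℂ := fun r =>
    s * Complex.I * freeWave s r - ((Real.sin r : ℂ) * S r + (Real.cos r : ℂ) * K r) with hg
  have hgc : ContinuousOn g (Ioi 0) :=
    (continuous_const.mul (continuous_freeWave s)).continuousOn.sub
      ((hsinc.continuousOn.mul hSc).add (hcosc.continuousOn.mul hKc))
  have hfd : ∀ r, 0 < r → HasDerivAt f (g r) r := by
    intro r hr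
    refine hasDerivAt_of_off_countable A.countable hf.1 hgc (fun x hx hxC => ?_) hr
    have hc := A.continuousAt x hx hxC
    have h1 := (hasDerivAt_freeWave s x).add (((hcosd x).mul (hSd x hx hc)).sub
      ((hsind x).mul (hKd x hx hc)))
    refine (h1.congr_of_eventuallyEq ?_).congr_deriv ?_
    · filter_upwards [Ioi_mem_nhds hx] with t ht using hfeq t ht
    · rw [hg]; ring
  have hgd : ∀ r, 0 < r → ContinuousAt q r →
      HasDerivAt g (((ν ^ 2 - 1 / 4) / (r : ℂ) ^ 2 + (q r : ℂ) - 1) * f r) r := by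
    intro r hr hc
    refine (((hasDerivAt_freeWave s r).const_mul (s * Complex.I)).sub
      (((hsind r).mul (hSd r hr hc)).add ((hcosd r).mul (hKd r hr hc)))).congr_deriv ?_
    have h2 : (Real.sin r : ℂ) ^ 2 + (Real.cos r : ℂ) ^ 2 = 1 := by
      exact_mod_cast Real.sin_sq_add_cos_sq r
    have h3 : f r = freeWave s r + ((Real.cos r : ℂ) * S r - (Real.sin r : ℂ) * K r) := hfeq r hr
    have h4 : (ν ^ 2 - 1 / 4) / (r : ℂ) ^ 2 + (q r : ℂ) = effectivePotential q ν r := rfl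
    rw [h4]
    linear_combination (effectivePotential q ν r * f r) * h2 + h3 - freeWave s r * hs2
      + s ^ 2 * freeWave s r * Complex.I_sq
  have hbdd : ∀ {u : ℝ → ℝ} {F : ℝ → ℂ}, (∀ r, |u r| ≤ 1) → Tendsto F atTop (𝓝 0) →
      Tendsto (fun r => (u r : ℂ) * F r) atTop (𝓝 0) := by
    intro u F hu hF
    refine squeeze_zero_norm (fun r => ?_) (tendsto_zero_iff_norm_tendsto_zero.1 hF)
    rw [norm_mul, Complex.norm_real, Real.norm_eq_abs]
    exact mul_le_of_le_one_left (norm_nonneg _) (hu r)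
  refine ⟨f, ⟨IsRadialSolution.of_hasDerivAt hfd hgc hgd, isEquivalent_freeWave_iff.2 ?_⟩, ?_⟩
  · rw [tendsto_div_freeWave_iff hs]
    have := (hbdd Real.abs_cos_le_one hSt).sub (hbdd Real.abs_sin_le_one hKt)
    rw [sub_zero] at this
    refine this.congr' ?_
    filter_upwards [eventually_gt_atTop 0] with r hr
    rw [hfeq r hr, jostVolterra]
    ring
  · rw [tendsto_div_freeWave_iff hs]
    have := ((hbdd Real.abs_sin_le_one hSt).add (hbdd Real.abs_cos_le_one hKt)).neg
    rw [add_zero, neg_zero] at this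
    refine this.congr' ?_
    filter_upwards [eventually_gt_atTop 0] with r hr
    rw [(hfd r hr).deriv, hg]
    ring

theorem freeWave_one_mul_neg_one (r : ℝ) : freeWave 1 r * freeWave (-1) r = 1 := by
  rw [freeWave, freeWave, ← Complex.exp_add]
  simp

/-- The Wronskian is constant, and its limit at infinity is `-2i`, since the two waves multiply to
`1`. -/
theorem Admissible.wronskian_jost (A : Admissible q δ C) {f g : ℝ → ℂ}
    (hf : IsJostSolution q ν 1 f) (hg : IsJostSolution q ν (-1) g)
    (hf' : Tendsto (fun r => deriv f r / freeWave 1 r) atTop (𝓝 (1 * Complex.I)))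
    (hg' : Tendsto (fun r => deriv g r / freeWave (-1) r) atTop (𝓝 (-1 * Complex.I))) :
    wronskian f g 1 ≠ 0 := by
  have h1 := isEquivalent_freeWave_iff.1 hf.asymptotic
  have h2 := isEquivalent_freeWave_iff.1 hg.asymptotic
  have h3 := (h1.mul hg').sub (hf'.mul h2)
  have h4 : Tendsto (fun _ : ℝ => wronskian f g 1) atTop
      (𝓝 (1 * (-1 * Complex.I) - 1 * Complex.I * 1)) := by
    refine h3.congr' ?_
    filter_upwards [eventually_gt_atTop 0] with r hr
    rw [A.wronskian_eq hf.solution hg.solution one_pos hr, wronskian, div_mul_div_comm,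
      div_mul_div_comm, freeWave_one_mul_neg_one]
    simp
  rw [tendsto_nhds_unique tendsto_const_nhds h4]
  intro h
  have := congrArg Complex.im h
  norm_num at this

/-- A shift by `π/2` multiplies the two waves by `i` and `-i`. Combining the hypothesis with its
shift isolates each wave, whose modulus is one, so its coefficient must vanish. -/
theorem eq_zero_of_tendsto_waves {a b : ℂ}
    (h : Tendsto (fun r => a * freeWave 1 r + b * freeWave (-1) r) atTop (𝓝 0)) :
    a = 0 ∧ b = 0 := by
  have hshift := h.comp (tendsto_atTop_add_const_right atTop (Real.pi / 2) tendsto_id)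
  have e1 : ∀ r : ℝ, freeWave 1 (r + Real.pi / 2) = Complex.I * freeWave 1 r := by
    intro r
    rw [freeWave, freeWave]
    push_cast
    rw [show (1 : ℂ) * Complex.I * (r + Real.pi / 2) = Real.pi / 2 * Complex.I
      + 1 * Complex.I * r by ring, Complex.exp_add, Complex.exp_pi_div_two_mul_I]
  have e2 : ∀ r : ℝ, freeWave (-1) (r + Real.pi / 2) = -Complex.I * freeWave (-1) r := by
    intro r
    rw [freeWave, freeWave]
    push_cast
    rw [show (-1 : ℂ) * Complex.I * (r + Real.pi / 2) = -Real.pi / 2 * Complex.I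
      + -1 * Complex.I * r by ring, Complex.exp_add, Complex.exp_neg_pi_div_two_mul_I]
  have hz : ∀ {c s : ℂ}, s.im = 0 → Tendsto (fun r => c * freeWave s r) atTop (𝓝 0) → c = 0 := by
    intro c s hs hc
    have h1 := tendsto_zero_iff_norm_tendsto_zero.1 hc
    simp only [norm_mul, norm_freeWave hs, mul_one] at h1
    exact norm_eq_zero.1 (tendsto_nhds_unique tendsto_const_nhds h1)
  have hi := hshift.const_mul Complex.I
  rw [mul_zero] at hi
  constructor
  · have h2 := (h.sub hi).const_mul (1 / 2)
    rw [sub_zero, mul_zero] at h2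
    refine hz (s := 1) (by simp) (h2.congr fun r => ?_)
    simp only [Function.comp, id, e1, e2]
    linear_combination (-a * freeWave 1 r / 2 + b * freeWave (-1) r / 2) * Complex.I_sq
  · have h2 := (h.add hi).const_mul (1 / 2)
    rw [add_zero, mul_zero] at h2
    refine hz (s := -1) (by simp) (h2.congr fun r => ?_)
    simp only [Function.comp, id, e1, e2]
    linear_combination (a * freeWave 1 r / 2 - b * freeWave (-1) r / 2) * Complex.I_sq

/-- A Jost solution is determined by its asymptotics, and so is the asymptotics of its
derivative. -/
theorem Admissible.tendsto_deriv_jost (A : Admissible q δ C) {s : ℂ} (hs : s = 1 ∨ s = -1)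
    {f : ℝ → ℂ} (hf : IsJostSolution q ν s f) :
    Tendsto (fun r => deriv f r / freeWave s r) atTop (𝓝 (s * Complex.I)) := by
  -- The given solution is expanded in the constructed pair `g`, `k`; comparing asymptotics forces
  -- it to equal `g` or `k`, whose derivatives are under control.
  obtain ⟨g, hg, hg'⟩ := A.exists_jost ν (s := 1) (by simp) (by simp)
  obtain ⟨k, hk, hk'⟩ := A.exists_jost ν (s := -1) (by simp) (by simp)
  obtain ⟨a, b, hab⟩ := A.exists_eq_combination hf.solution hg.solution hk.solution
    (A.wronskian_jost hg hk hg' hk')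
  have tg := (tendsto_div_freeWave_iff (by simp)).1 (isEquivalent_freeWave_iff.1 hg.asymptotic)
  have tk := (tendsto_div_freeWave_iff (by simp)).1 (isEquivalent_freeWave_iff.1 hk.asymptotic)
  have tf := (tendsto_div_freeWave_iff (by rcases hs with rfl | rfl <;> simp)).1
    (isEquivalent_freeWave_iff.1 hf.asymptotic)
  have h := tf.sub ((tg.const_mul a).add (tk.const_mul b))
  simp only [mul_zero, add_zero, sub_zero] at h
  have hcongr : ∀ {k : ℝ → ℂ}, (∀ r, 0 < r → f r = k r) →
      Tendsto (fun r => deriv k r / freeWave s r) atTop (𝓝 (s * Complex.I)) →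
      Tendsto (fun r => deriv f r / freeWave s r) atTop (𝓝 (s * Complex.I)) := by
    intro k hfk hk
    refine hk.congr' ?_
    filter_upwards [eventually_gt_atTop 0] with r hr
    have : f =ᶠ[𝓝 r] k := by
      filter_upwards [Ioi_mem_nhds hr] with x hx using hfk x hx
    rw [this.deriv_eq]
  rcases hs with rfl | rfl
  · have h2 : Tendsto (fun r => (a - 1) * freeWave 1 r + b * freeWave (-1) r) atTop (𝓝 0) := by
      refine h.congr' ?_
      filter_upwards [eventually_gt_atTop 0] with r hr
      rw [hab r hr]; ring
    obtain ⟨h3, h4⟩ := eq_zero_of_tendsto_waves h2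
    refine hcongr (fun r hr => ?_) hg'
    rw [hab r hr, h4, sub_eq_zero.1 h3]; ring
  · have h2 : Tendsto (fun r => a * freeWave 1 r + (b - 1) * freeWave (-1) r) atTop (𝓝 0) := by
      refine h.congr' ?_
      filter_upwards [eventually_gt_atTop 0] with r hr
      rw [hab r hr]; ring
    obtain ⟨h3, h4⟩ := eq_zero_of_tendsto_waves h2
    refine hcongr (fun r hr => ?_) hk'
    rw [hab r hr, h3, sub_eq_zero.1 h4]; ring

end Jost

/-! ### Behaviour at the origin of an arbitrary regular solution. -/

section Origin

variable {q : ℝ → ℝ} {ν : ℂ} {δ : ℝ} {C : Set ℝ}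

/-- If `v' = r ^ (-(2ν + 1)) z` with `Re ν ≥ 0`, and `v` and `z` converge at the origin, then
`z → 0`. -/
theorem eq_zero_of_tendsto_amplitude {v z : ℝ → ℂ} {l c : ℂ} (hν : 0 ≤ ν.re)
    (hd : ∀ r : ℝ, 0 < r → HasDerivAt v ((r : ℂ) ^ (-(2 * ν + 1)) * z r) r)
    (hv : Tendsto v (𝓝[>] 0) (𝓝 l)) (hz : Tendsto z (𝓝[>] 0) (𝓝 c)) : c = 0 := by
  by_contra hc
  have hcpos : 0 < ‖c‖ := norm_pos_iff.2 hc
  -- If `c ≠ 0`, then `v'` is close to `c r ^ (-(2ν + 1))`, of size at least of order `1/r`. With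
  -- `η` small enough that this power hardly turns on `[r, (1 + η) r]`, the increment of `v` there
  -- stays away from `0`, against convergence of `v`.
  obtain ⟨η, hη, hpow⟩ : ∃ η : ℝ, 0 < η ∧ ∀ x : ℝ, 1 ≤ x → x ≤ 1 + η →
      ‖(x : ℂ) ^ (-(2 * ν + 1)) - 1‖ ≤ 1 / 8 := by
    have h1 : ContinuousAt (fun x : ℝ => (x : ℂ) ^ (-(2 * ν + 1))) 1 :=
      (hasDerivAt_ofReal_cpow one_pos _).continuousAt
    obtain ⟨η, hη, h⟩ := Metric.continuousAt_iff.1 h1 (1 / 8) (by norm_num)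
    refine ⟨η / 2, half_pos hη, fun x hx1 hx2 => ?_⟩
    have h2 := h (x := x) (by rw [Real.dist_eq, abs_of_nonneg (by linarith)]; linarith)
    rw [dist_eq_norm] at h2
    simpa using h2.le
  have hzev : ∀ᶠ r in 𝓝[>] (0 : ℝ), ‖z r - c‖ < ‖c‖ / 8 := by
    have := Metric.tendsto_nhds.1 hz (‖c‖ / 8) (by positivity)
    simpa only [dist_eq_norm] using this
  obtain ⟨ρ, hρ, hzρ⟩ := mem_nhdsGT_iff_exists_Ioo_subset.1 hzev
  have hρ0 : (0 : ℝ) < ρ := hρ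
  have hscale : Tendsto (fun r : ℝ => (1 + η) * r) (𝓝[>] 0) (𝓝[>] 0) := by
    refine tendsto_nhdsWithin_iff.2 ⟨?_, ?_⟩
    · have : Tendsto (fun r : ℝ => (1 + η) * r) (𝓝 0) (𝓝 ((1 + η) * 0)) :=
        (continuous_const.mul continuous_id).tendsto 0
      rw [mul_zero] at this
      exact this.mono_left nhdsWithin_le_nhds
    · filter_upwards [self_mem_nhdsWithin] with r hr
      have hr0 : (0 : ℝ) < r := hr
      change 0 < (1 + η) * r
      positivity
  have hdiff : Tendsto (fun r : ℝ => v ((1 + η) * r) - v r) (𝓝[>] 0) (𝓝 0) := by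
    simpa using (hv.comp hscale).sub hv
  have hlow : ∀ᶠ r : ℝ in 𝓝[>] 0, ‖c‖ * η / 2 ≤ ‖v ((1 + η) * r) - v r‖ := by
    have hmem : Ioo (0 : ℝ) (min 1 (ρ / (1 + η))) ∈ 𝓝[>] (0 : ℝ) :=
      Ioo_mem_nhdsGT (lt_min one_pos (div_pos hρ0 (by linarith)))
    filter_upwards [hmem] with r hr
    have hr0 : 0 < r := hr.1
    have hr1 : r < 1 := hr.2.trans_le (min_le_left _ _)
    have hrρ : (1 + η) * r < ρ := by
      have := hr.2.trans_le (min_le_right _ _)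
      rw [lt_div_iff₀ (by linarith)] at this
      linarith
    set P : ℂ := (r : ℂ) ^ (-(2 * ν + 1)) with hP
    -- Here `r ‖P‖ = r ^ (-2 Re ν)`, with `r < 1` and `Re ν ≥ 0`.
    have hPn : r * ‖P‖ ≥ 1 := by
      rw [hP, Complex.norm_cpow_eq_rpow_re_of_pos hr0]
      have : (-(2 * ν + 1)).re = -(2 * ν.re) - 1 := by simp; ring
      rw [this, Real.rpow_sub_one hr0.ne', mul_div_cancel₀ _ hr0.ne']
      exact Real.one_le_rpow_of_pos_of_le_one_of_nonpos hr0 hr1.le (by linarith)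
    -- Mean value inequality for `v` minus the linear function of slope `P * c`. The error in the
    -- derivative is at most `‖P‖ ‖c‖ (1/8 * 9/8 + 1/8)`, less than half the slope.
    have hmv : ‖(v ((1 + η) * r) - P * c * (((1 + η) * r : ℝ) : ℂ)) - (v r - P * c * (r : ℂ))‖ ≤
        ‖P‖ * ‖c‖ / 2 * ‖(1 + η) * r - r‖ := by
      refine Convex.norm_image_sub_le_of_norm_hasDerivWithin_le (𝕜 := ℝ) (s := Icc r ((1 + η) * r))
        (f := fun x : ℝ => v x - P * c * (x : ℂ))
        (f' := fun x : ℝ => (x : ℂ) ^ (-(2 * ν + 1)) * z x - P * c) ?_ ?_ (convex_Icc _ _)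
        (left_mem_Icc.2 (by nlinarith)) (right_mem_Icc.2 (by nlinarith))
      · intro x hx
        have h1 := (Complex.ofRealCLM.hasDerivAt (x := x)).const_mul (P * c)
        refine ((hd x (hr0.trans_le hx.1)).sub (h1.congr_deriv ?_)).hasDerivWithinAt
        simp
      · intro x hx
        have hx0 : 0 < x := hr0.trans_le hx.1
        have hzx : ‖z x - c‖ < ‖c‖ / 8 := hzρ ⟨hx0, hx.2.trans_lt hrρ⟩
        have hq := hpow (x / r) ((one_le_div hr0).2 hx.1) ((div_le_iff₀ hr0).2 hx.2)
        have hxp : (x : ℂ) ^ (-(2 * ν + 1)) = P * ((x / r : ℝ) : ℂ) ^ (-(2 * ν + 1)) := by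
          rw [hP, ← Complex.mul_cpow_ofReal_nonneg hr0.le (div_pos hx0 hr0).le,
            ← Complex.ofReal_mul, mul_div_cancel₀ _ hr0.ne']
        set w : ℂ := ((x / r : ℝ) : ℂ) ^ (-(2 * ν + 1)) with hw
        have hzn : ‖z x‖ ≤ 9 / 8 * ‖c‖ := by
          have := norm_add_le (z x - c) c
          rw [sub_add_cancel] at this
          linarith
        have e : (x : ℂ) ^ (-(2 * ν + 1)) * z x - P * c = P * ((w - 1) * z x + (z x - c)) := by
          rw [hxp]; ring
        rw [e, norm_mul, mul_div_assoc]
        refine mul_le_mul_of_nonneg_left ?_ (norm_nonneg _)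
        refine (norm_add_le _ _).trans ?_
        rw [norm_mul]
        have := mul_le_mul hq hzn (norm_nonneg _) (by norm_num)
        linarith
    have e2 : P * c * ((η * r : ℝ) : ℂ) = (v ((1 + η) * r) - v r) -
        ((v ((1 + η) * r) - P * c * (((1 + η) * r : ℝ) : ℂ)) - (v r - P * c * (r : ℂ))) := by
      push_cast; ring
    have hηr : 0 < η * r := mul_pos hη hr0
    have h3 : ‖P‖ * ‖c‖ * (η * r) ≤ ‖v ((1 + η) * r) - v r‖ + ‖P‖ * ‖c‖ / 2 * (η * r) := by
      have h4 := norm_sub_le (v ((1 + η) * r) - v r)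
        ((v ((1 + η) * r) - P * c * (((1 + η) * r : ℝ) : ℂ)) - (v r - P * c * (r : ℂ)))
      rw [← e2, norm_mul, norm_mul, Complex.norm_real, Real.norm_of_nonneg hηr.le] at h4
      have h5 : ‖(1 + η) * r - r‖ = η * r := by
        rw [show (1 + η) * r - r = η * r by ring, Real.norm_of_nonneg hηr.le]
      rw [h5] at hmv
      linarith
    have h6 : ‖c‖ * η * 1 ≤ ‖c‖ * η * (r * ‖P‖) :=
      mul_le_mul_of_nonneg_left hPn (by positivity)
    linarith
  have := ge_of_tendsto (tendsto_zero_iff_norm_tendsto_zero.1 hdiff) hlow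
  have : 0 < ‖c‖ * η / 2 := by positivity
  linarith

theorem hasDerivAt_amplitude {u : ℝ → ℂ} (hu : IsRadialSolution q ν u) {r : ℝ} (hr : 0 < r) :
    HasDerivAt (amplitude ν u) ((r : ℂ) ^ (-(2 * ν + 1)) * quasiDeriv ν u r) r := by
  have hr0 := ofReal_ne_zero_of_pos hr
  refine ((hasDerivAt_ofReal_cpow hr (-(ν + 1 / 2))).mul (hu.hasDerivAt hr)).congr_deriv ?_
  have e1 : (r : ℂ) ^ (-(ν + 1 / 2)) = (r : ℂ) ^ (-(2 * ν + 1)) * (r : ℂ) ^ (ν + 1 / 2) := by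
    rw [← Complex.cpow_add _ _ hr0]; congr 1; ring
  have e2 : (r : ℂ) ^ (-(ν + 1 / 2) - 1) = (r : ℂ) ^ (-(2 * ν + 1)) * (r : ℂ) ^ (ν - 1 / 2) := by
    rw [← Complex.cpow_add _ _ hr0]; congr 1; ring
  rw [e1, e2, quasiDeriv]
  ring

theorem wronskian_eq_amplitude (u w : ℝ → ℂ) {r : ℝ} (hr : 0 < r) :
    wronskian u w r = amplitude ν u r * quasiDeriv ν w r - quasiDeriv ν u r * amplitude ν w r := by
  have hr0 := ofReal_ne_zero_of_pos hr
  have e1 : (r : ℂ) ^ (-(ν + 1 / 2)) * (r : ℂ) ^ (ν + 1 / 2) = 1 := by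
    rw [← Complex.cpow_add _ _ hr0]; simp
  simp only [wronskian, amplitude, quasiDeriv]
  linear_combination -(u r * deriv w r - deriv u r * w r) * e1

/-- The constant Wronskian with the constructed regular solution can be solved for the
quasi-derivative of `φ`, which therefore converges; `eq_zero_of_tendsto_amplitude` then excludes a
nonzero limit. -/
theorem Admissible.tendsto_quasiDeriv (A : Admissible q δ C) (hν : 0 ≤ ν.re) {φ : ℝ → ℂ}
    (hφ : IsRegularSolution q ν φ) : Tendsto (quasiDeriv ν φ) (𝓝[>] 0) (𝓝 0) := by
  obtain ⟨φ₀, hφ₀, hz₀⟩ := A.exists_regular hν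
  have hv := isEquivalent_cpow_iff.1 hφ.asymptotic
  have hv₀ := isEquivalent_cpow_iff.1 hφ₀.asymptotic
  have h1 : Tendsto (fun r => (amplitude ν φ r * quasiDeriv ν φ₀ r - wronskian φ φ₀ 1) /
      amplitude ν φ₀ r) (𝓝[>] 0) (𝓝 ((1 * 0 - wronskian φ φ₀ 1) / 1)) :=
    ((hv.mul hz₀).sub_const _).div hv₀ one_ne_zero
  have h2 : Tendsto (quasiDeriv ν φ) (𝓝[>] 0) (𝓝 ((1 * 0 - wronskian φ φ₀ 1) / 1)) := by
    refine h1.congr' ?_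
    filter_upwards [self_mem_nhdsWithin, hv₀.eventually_ne one_ne_zero] with r hr hne
    rw [A.wronskian_eq hφ.solution hφ₀.solution one_pos hr, wronskian_eq_amplitude (ν := ν) _ _ hr]
    field_simp
    ring
  rwa [eq_zero_of_tendsto_amplitude hν (fun r hr => hasDerivAt_amplitude hφ.solution hr) hv h2]
    at h2

end Origin

/-! ### Monotonicity and limits of the current. -/

section Current

variable {q : ℝ → ℝ} {ν : ℂ} {δ : ℝ} {C : Set ℝ}

/-- The current `Im (u' ū)`. -/
def current (u : ℝ → ℂ) (r : ℝ) : ℝ := (deriv u r * (starRingEnd ℂ) (u r)).im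

theorem Admissible.hasDerivAt_current (A : Admissible q δ C) {u : ℝ → ℂ}
    (hu : IsRadialSolution q ν u) {r : ℝ} (hr : 0 < r) :
    HasDerivAt (current u) ((ν ^ 2).im * Complex.normSq (u r) / r ^ 2) r := by
  refine hasDerivAt_of_off_countable (g := fun r => (ν ^ 2).im * Complex.normSq (u r) / r ^ 2)
    A.countable ?_ ?_ (fun x hx hxC => ?_) hr
  · exact Complex.continuous_im.comp_continuousOn
      (hu.continuousOn_deriv.mul (Complex.continuous_conj.comp_continuousOn hu.continuousOn))
  · exact (continuousOn_const.mul (Complex.continuous_normSq.comp_continuousOn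
      hu.continuousOn)).div (continuous_pow 2).continuousOn fun x hx => pow_ne_zero 2 (ne_of_gt hx)
  · have h1 := ((hu.hasDerivAt_deriv hx (A.continuousAt x hx hxC)).mul
      (hu.hasDerivAt hx).star)
    have h2 := (Complex.imCLM.hasFDerivAt.comp_hasDerivAt x h1)
    refine h2.congr_deriv ?_
    have e1 : ((ν ^ 2 - 1 / 4) / (x : ℂ) ^ 2 + (q x : ℂ) - 1) * u x * star (u x) +
        deriv u x * star (deriv u x) =
        ((ν ^ 2 - 1 / 4) / (x : ℂ) ^ 2 + (q x : ℂ) - 1) * (Complex.normSq (u x) : ℂ) +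
        (Complex.normSq (deriv u x) : ℂ) := by
      rw [← Complex.mul_conj, ← Complex.mul_conj]
      simp only [starRingEnd_apply]
      ring
    rw [Complex.imCLM_apply, e1, ← Complex.ofReal_pow, Complex.add_im, Complex.ofReal_im, add_zero,
      Complex.im_mul_ofReal, Complex.sub_im, Complex.add_im, Complex.div_ofReal_im]
    simp
    ring

/-- Isolates the two effects at the origin: the factor made of powers of `r` has modulus one, so the
first term is controlled by the quasi-derivative, and the second has the sign of `Im ν`. -/
theorem current_eq_amplitude (u : ℝ → ℂ) {r : ℝ} (hr : 0 < r) :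
    current u r = (quasiDeriv ν u r * (starRingEnd ℂ) (amplitude ν u r) *
      ((r : ℂ) ^ (-(ν + 1 / 2)) * (starRingEnd ℂ) ((r : ℂ) ^ (ν + 1 / 2)))).im +
      ν.im * Complex.normSq (u r) / r := by
  have hr0 := ofReal_ne_zero_of_pos hr
  have e1 : (r : ℂ) ^ (-(ν + 1 / 2)) * (r : ℂ) ^ (ν + 1 / 2) = 1 := by
    rw [← Complex.cpow_add _ _ hr0]; simp
  have e2 : (starRingEnd ℂ) ((r : ℂ) ^ (-(ν + 1 / 2))) *
      (starRingEnd ℂ) ((r : ℂ) ^ (ν + 1 / 2)) = 1 := by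
    rw [← map_mul, e1, map_one]
  have e3 : (r : ℂ) ^ (-(ν + 1 / 2)) * (r : ℂ) ^ (ν - 1 / 2) = (r : ℂ)⁻¹ := by
    rw [← Complex.cpow_add _ _ hr0, ← Complex.cpow_neg_one]; congr 1; ring
  have e4 : quasiDeriv ν u r * (starRingEnd ℂ) (amplitude ν u r) *
      ((r : ℂ) ^ (-(ν + 1 / 2)) * (starRingEnd ℂ) ((r : ℂ) ^ (ν + 1 / 2))) =
      deriv u r * (starRingEnd ℂ) (u r) -
        (ν + 1 / 2) * ((Complex.normSq (u r) / r : ℝ) : ℂ) := by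
    rw [Complex.ofReal_div, ← Complex.mul_conj, div_eq_mul_inv _ (r : ℂ), ← e3]
    simp only [quasiDeriv, amplitude, map_mul]
    generalize (starRingEnd ℂ) ((r : ℂ) ^ (-(ν + 1 / 2))) = p at *
    generalize (starRingEnd ℂ) ((r : ℂ) ^ (ν + 1 / 2)) = p' at *
    generalize (r : ℂ) ^ (-(ν + 1 / 2)) = m at *
    generalize (r : ℂ) ^ (ν + 1 / 2) = m' at *
    generalize (r : ℂ) ^ (ν - 1 / 2) = k at *
    linear_combination (m * m' * deriv u r * (starRingEnd ℂ) (u r) -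
      (ν + 1 / 2) * m * k * u r * (starRingEnd ℂ) (u r)) * e2 +
      deriv u r * (starRingEnd ℂ) (u r) * e1
  rw [e4, current, Complex.sub_im, Complex.im_mul_ofReal]
  simp
  ring

/-- The current of the regular solution has, up to sign, a nonnegative value everywhere when
`Im ν` has that sign. -/
theorem Admissible.current_nonneg (A : Admissible q δ C) (hν : 0 ≤ ν.re) {σ : ℝ}
    (hσ : |σ| = 1) (hσν : 0 ≤ σ * ν.im) {φ : ℝ → ℂ} (hφ : IsRegularSolution q ν φ) {r : ℝ}
    (hr : 0 < r) : 0 ≤ σ * current φ r := by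
  have hd : ∀ x, 0 < x → HasDerivAt (fun x => σ * current φ x)
      (σ * ((ν ^ 2).im * Complex.normSq (φ x) / x ^ 2)) x :=
    fun x hx => (A.hasDerivAt_current hφ.solution hx).const_mul σ
  have hmono : MonotoneOn (fun x => σ * current φ x) (Ioi 0) := by
    refine monotoneOn_of_deriv_nonneg (convex_Ioi 0)
      (fun x hx => (hd x hx).continuousAt.continuousWithinAt) ?_ ?_ <;> rw [interior_Ioi]
    · exact fun x hx => (hd x hx).differentiableAt.differentiableWithinAt
    · intro x hx
      rw [(hd x hx).deriv]
      have e : (ν ^ 2).im = 2 * (ν.re * ν.im) := by rw [pow_two, Complex.mul_im]; ring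
      have : σ * ((ν ^ 2).im * Complex.normSq (φ x) / x ^ 2) =
          2 * ν.re * (σ * ν.im) * Complex.normSq (φ x) / x ^ 2 := by rw [e]; ring
      rw [this]
      have := Complex.normSq_nonneg (φ x)
      positivity
  -- A lower bound for `σ * current φ x` near the origin; it tends to `0`, and monotonicity carries
  -- it to `r`.
  have hlim : Tendsto (fun x => -(‖quasiDeriv ν φ x‖ * ‖amplitude ν φ x‖)) (𝓝[>] 0) (𝓝 0) := by
    have := ((A.tendsto_quasiDeriv hν hφ).norm.mul
      (isEquivalent_cpow_iff.1 hφ.asymptotic).norm).neg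
    simpa using this
  refine le_of_tendsto hlim ?_
  filter_upwards [Ioc_mem_nhdsGT hr] with x hx
  refine le_trans ?_ (hmono hx.1 hr hx.2)
  have hx0 := ofReal_ne_zero_of_pos hx.1
  simp only
  rw [current_eq_amplitude (ν := ν) φ hx.1, mul_add]
  set w := quasiDeriv ν φ x * (starRingEnd ℂ) (amplitude ν φ x) *
      ((x : ℂ) ^ (-(ν + 1 / 2)) * (starRingEnd ℂ) ((x : ℂ) ^ (ν + 1 / 2))) with hw
  have hwn : ‖w‖ = ‖quasiDeriv ν φ x‖ * ‖amplitude ν φ x‖ := by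
    rw [hw, norm_mul, norm_mul, norm_mul, RCLike.norm_conj, RCLike.norm_conj,
      ← norm_mul ((x : ℂ) ^ _), ← Complex.cpow_add _ _ hx0]
    simp
  have h1 : -‖w‖ ≤ σ * w.im := by
    refine neg_le_of_abs_le ?_
    rw [abs_mul, hσ, one_mul]
    exact Complex.abs_im_le_norm w
  have h2 : 0 ≤ σ * (ν.im * Complex.normSq (φ x) / x) := by
    have e : σ * (ν.im * Complex.normSq (φ x) / x) = σ * ν.im * Complex.normSq (φ x) / x := by ring
    rw [e]
    exact div_nonneg (mul_nonneg hσν (Complex.normSq_nonneg _)) hx.1.le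
  rw [← hwn]
  linarith

theorem Admissible.tendsto_current_jost (A : Admissible q δ C) {s : ℂ} (hs : s = 1 ∨ s = -1)
    {f φ : ℝ → ℂ} {c : ℂ} (hf : IsJostSolution q ν s f) (hφ : ∀ r, 0 < r → φ r = c * f r) :
    Tendsto (current φ) atTop (𝓝 (s.re * Complex.normSq c)) := by
  have hs0 : s.im = 0 := by rcases hs with rfl | rfl <;> simp
  have h1 := isEquivalent_freeWave_iff.1 hf.asymptotic
  have h2 := A.tendsto_deriv_jost hs hf
  have h3 := (Complex.continuous_im.tendsto _).comp
    (((h2.const_mul c).mul ((Complex.continuous_conj.tendsto _).comp (h1.const_mul c))))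
  have e : (c * (s * Complex.I) * (starRingEnd ℂ) (c * 1)).im = s.re * Complex.normSq c := by
    have : c * (s * Complex.I) * (starRingEnd ℂ) (c * 1) =
        s * Complex.I * (Complex.normSq c : ℂ) := by
      rw [← Complex.mul_conj, mul_one]; ring
    rw [this, Complex.im_mul_ofReal]
    simp
  rw [e] at h3
  refine h3.congr' ?_
  filter_upwards [eventually_gt_atTop 0] with r hr
  have hev : φ =ᶠ[𝓝 r] fun x => c * f x := by
    filter_upwards [Ioi_mem_nhds hr] with x hx using hφ x hx
  have hn : freeWave s r * (starRingEnd ℂ) (freeWave s r) = 1 := by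
    rw [Complex.mul_conj, Complex.normSq_eq_norm_sq, norm_freeWave hs0]; simp
  have hne : freeWave s r ≠ 0 := Complex.exp_ne_zero _
  simp only [Function.comp, current]
  rw [hev.deriv_eq, hφ r hr, ((hf.solution.hasDerivAt hr).const_mul c).deriv]
  congr 1
  -- Conjugation inverts the wave, so normalising both `f'` and `f` by it leaves the current
  -- unchanged.
  have hinv : (starRingEnd ℂ) (freeWave s r) = 1 / freeWave s r :=
    eq_div_of_mul_eq hne (by rw [mul_comm, hn])
  rw [map_mul, map_mul, map_div₀, hinv]
  field_simp

/-- The regular solution is not a multiple of the Jost solution that is incoming relative to the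
sign of `Im ν`. -/
theorem Admissible.regular_ne_mul_jost (A : Admissible q δ C) (hν : 0 ≤ ν.re) {σ : ℝ}
    (hσ : σ = 1 ∨ σ = -1) (hσν : 0 ≤ σ * ν.im) {f φ : ℝ → ℂ} {c : ℂ}
    (hφ : IsRegularSolution q ν φ) (hf : IsJostSolution q ν (-σ : ℝ) f)
    (h : ∀ r, 0 < r → φ r = c * f r) : False := by
  have hσ1 : |σ| = 1 := by rcases hσ with rfl | rfl <;> simp
  have hs : ((-σ : ℝ) : ℂ) = 1 ∨ ((-σ : ℝ) : ℂ) = -1 := by rcases hσ with rfl | rfl <;> simp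
  have h1 := (A.tendsto_current_jost hs hf h).const_mul σ
  -- The limit of `σ` times the current is `-σ² |c|²`, yet a limit of nonnegative values.
  have h2 : 0 ≤ σ * (((-σ : ℝ) : ℂ).re * Complex.normSq c) := by
    refine ge_of_tendsto h1 ?_
    filter_upwards [eventually_gt_atTop 0] with r hr using A.current_nonneg hν hσ1 hσν hφ hr
  have h3 : Complex.normSq c = 0 := by
    have h4 := Complex.normSq_nonneg c
    rw [Complex.ofReal_re] at h2
    rcases hσ with rfl | rfl <;> linarith
  have hc : c = 0 := Complex.normSq_eq_zero.1 h3
  have h5 := isEquivalent_cpow_iff.1 hφ.asymptotic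
  have h6 : Tendsto (amplitude ν φ) (𝓝[>] 0) (𝓝 0) := by
    refine tendsto_const_nhds.congr' ?_
    filter_upwards [self_mem_nhdsWithin] with r hr
    rw [amplitude, h r hr, hc]
    simp
  exact zero_ne_one (tendsto_nhds_unique h6 h5)

end Current

/-! ### The Jost functions and their nonvanishing. -/

section Main

variable {q : ℝ → ℝ} {ν : ℂ} {δ : ℝ} {C : Set ℝ}

theorem Admissible.regularSolution_spec (A : Admissible q δ C) (hν : 0 ≤ ν.re) :
    IsRegularSolution q ν (regularSolution q ν) := by
  have h : ∃ φ, IsRegularSolution q ν φ := (A.exists_regular hν).imp fun _ h => h.1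
  rw [regularSolution, dif_pos h]
  exact h.choose_spec

theorem Admissible.jostSolution_spec (A : Admissible q δ C) {s : ℂ} (hs : s = 1 ∨ s = -1) :
    IsJostSolution q ν s (jostSolution q s ν) := by
  have h : ∃ f, IsJostSolution q ν s f :=
    (A.exists_jost ν (by rcases hs with rfl | rfl <;> simp)
      (by rcases hs with rfl | rfl <;> simp)).imp fun _ h => h.1
  rw [jostSolution, dif_pos h]
  exact h.choose_spec

/-- The Jost solutions have nonzero Wronskian, so the coefficients exist and the default value in
`jostPair` does not occur. -/
theorem Admissible.jostPair_spec (A : Admissible q δ C) (hν : 0 ≤ ν.re) {r : ℝ} (hr : 0 < r) :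
    regularSolution q ν r =
      jostAlpha q ν * jostSolution q 1 ν r + jostBeta q ν * jostSolution q (-1) ν r := by
  have hp := A.jostSolution_spec (ν := ν) (Or.inl rfl)
  have hm := A.jostSolution_spec (ν := ν) (Or.inr rfl)
  have h : ∃ c, IsJostPair q ν c := by
    obtain ⟨a, b, hab⟩ := A.exists_eq_combination (A.regularSolution_spec hν).solution
      hp.solution hm.solution (A.wronskian_jost hp hm (A.tendsto_deriv_jost (Or.inl rfl) hp)
        (A.tendsto_deriv_jost (Or.inr rfl) hm))
    exact ⟨(a, b), hab⟩
  have h2 : IsJostPair q ν (jostPair q ν) := by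
    rw [jostPair, dif_pos h]
    exact h.choose_spec
  exact h2 r hr

theorem Admissible.jostAlpha_ne_zero (A : Admissible q δ C) (hν : ν ∈ firstQuadrant) :
    jostAlpha q ν ≠ 0 := by
  intro h
  refine A.regular_ne_mul_jost hν.1 (σ := 1) (Or.inl rfl) (by simpa using hν.2)
    (A.regularSolution_spec hν.1) (f := jostSolution q (-1) ν) (c := jostBeta q ν) ?_
    fun r hr => ?_
  · simpa using A.jostSolution_spec (ν := ν) (Or.inr rfl)
  · rw [A.jostPair_spec hν.1 hr, h, zero_mul, zero_add]

theorem Admissible.jostBeta_ne_zero (A : Admissible q δ C) (hν : ν ∈ fourthQuadrant) :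
    jostBeta q ν ≠ 0 := by
  intro h
  refine A.regular_ne_mul_jost hν.1 (σ := -1) (Or.inr rfl) (by simpa using hν.2)
    (A.regularSolution_spec hν.1) (f := jostSolution q 1 ν) (c := jostAlpha q ν) ?_
    fun r hr => ?_
  · simpa using A.jostSolution_spec (ν := ν) (Or.inl rfl)
  · rw [A.jostPair_spec hν.1 hr, h, zero_mul, add_zero]

end Main

end ReggePoles

end

theorem mainTheorem12 (q : ℝ → ℝ) (hq : ReggePoles.PiecewiseContinuous q)
    (h1 : ReggePoles.HypH1 q) (h2 : ReggePoles.HypH2 q) :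
    (∀ ν ∈ ReggePoles.firstQuadrant, ReggePoles.jostAlpha q ν ≠ 0) ∧
    (∀ ν ∈ ReggePoles.fourthQuadrant, ReggePoles.jostBeta q ν ≠ 0) ∧
    ReggePoles.reggePoles q ⊆ ReggePoles.firstQuadrant := by
  obtain ⟨δ, C, A⟩ := ReggePoles.exists_admissible hq h1 h2
  refine ⟨fun ν hν => A.jostAlpha_ne_zero hν, fun ν hν => A.jostBeta_ne_zero hν, fun ν hν => ?_⟩
  refine ⟨hν.1, ?_⟩
  by_contra him
  exact A.jostBeta_ne_zero ⟨hν.1, (not_le.1 him).le⟩ hν.2
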